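/- Let $K$ be a field, let $G$ be a finite group, and let $G$ act faithfully via $\beta$ by $K$-automorphisms on a normal integral affine $K$-scheme $Y=\operatorname{Spec} S$ (that is, $S$ is an integrally closed domain) with a unique fixed $K$-point $Q$. Let $R=S^G$ and $X=Y/\beta=\operatorname{Spec} R$, and let $m\ge 0$. A product action on $Y\times\mathbb A^m$, linear in the second component, is an action of $G$ on $Y\times\mathbb A^m=\operatorname{Spec} S[W_1,\ldots,W_m]$ by $K$-automorphisms that is $\beta$ on $Y$ and is a linear action on the factor $\mathbb A^m$ (every $g\in G$ sends each $W_i$ to a $K$-linear combination of $W_1,\ldots,W_m$). For a product action $\sigma$ let $Z_\sigma=(Y\times\mathbb A^m)/\sigma=\operatorname{Spec} S[W_1,\ldots,W_m]^{\sigma}\to X$; for a linear representation $\rho:G\to \operatorname{GL}_m(K)$ let $\beta\times\rho$ be the product action $g(y,v)=(g y,\rho(g)v)$. Then $\rho\mapsto \beta\times\rho$ and $\sigma\mapsto (Z_\sigma\to X)$ induce bijections between 1. linear representations of $G$ of dimension $m$, up to equivalence; 2. product actions of $G$ on $Y\times\mathbb A^m$, linear in the second component, up to isomorphism of $G$-equivariant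 vector bundles over $Y$; 3. quotient schemes $(Y\times\mathbb A^m)/(\beta\times\rho)\to X$, up to isomorphism of schemes over $X$. The inverse of the first bijection assigns to $\sigma$ the (linear) representation of $G$ that $\sigma$ induces on the fiber $\mathbb A^m_Q$ over the fixed point $Q$; it is uniquely determined by $\sigma$. The inverse of the second bijection is normalization of the pull-back: a product action $\tau$ is equivalent to $\sigma$ if and only if there is a morphism $Y\times\mathbb A^m\to Y\times_X Z_\sigma$ over $Y$ which is $G$-equivariant (for $\tau$ on the left and for the action on the first factor on the right) and which is the normalization (the normalization of the reduction, in its field of fractions). Moreover, two product actions are already equivalent in the sense of (2) if they are isomorphic by a $G$-equivariant isomorphism of vector bundles lying over some $G$-equivariant $K$-automorphism of $Y$; and $Z_\sigma$ and $Z_\tau$ are isomorphic as schemes over $X$ if and only if they are linearly isomorphic over $X$, that is, by an isomorphism that is, in both directions, compatible with the scalar multiplications $\mathbb A^1\times Z\to Z$ and lifts to a morphism between the schemes $(Y\times\mathbb A^m\times\mathbb A^m)/G$ (which map to $Z\times_X Z$) compatible with the additions $(Y\times\mathbb A^m\times\mathbb A^m)/G\to Z$, all these maps being induced by the vector bundle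 structure of $Y\times\mathbb A^m$. -/

import Mathlib

open CategoryTheory AlgebraicGeometry
open scoped TensorProduct

universe u v w

namespace QuotientCorrespondence

section Actions

variable {K : Type v} [Field K] {G : Type w} [Group G] {S : Type u} [CommRing S] [Algebra K S]

/-- A `K`-point `ε` of `Y = Spec S` is fixed by the action `β` of `G` on `S`. -/
def IsFixedPoint (β : G →* (S ≃ₐ[K] S)) (ε : S →ₐ[K] K) : Prop :=
  ∀ g s, ε (β g s) = ε s

/-- An action of `G` on `Y × 𝔸^ι = Spec S[W_i]` by `K`-automorphisms which is the product of the
basic action `β` on `Y = Spec S` and a linear action on the second factor `𝔸^ι = Spec K[W_i]`: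
every `g` acts as `β g` on `S` and sends each coordinate `W_i` to a `K`-linear combination of
the coordinates. (A left action on a scheme and a left action on its functions are related by
`(g f)(z) = f (g⁻¹ z)`.) -/
structure ProductAction (β : G →* (S ≃ₐ[K] S)) (ι : Type) where
  act : G →* (MvPolynomial ι S ≃ₐ[K] MvPolynomial ι S)
  compat : ∀ g s, act g (MvPolynomial.C s) = MvPolynomial.C (β g s)
  linear : ∀ g i, act g (MvPolynomial.X i) ∈
    Submodule.span K (Set.range (MvPolynomial.X : ι → MvPolynomial ι S))

/-- The `K`-algebra endomorphism of `S[W_i]` that acts as `f` on `S` and sends `W_i` to `v i`. -/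
noncomputable def substHom (f : S ≃ₐ[K] S) {ι : Type} (v : ι → MvPolynomial ι S) :
    MvPolynomial ι S →ₐ[K] MvPolynomial ι S :=
  ((MvPolynomial.aeval v : MvPolynomial ι S →ₐ[S] MvPolynomial ι S).restrictScalars K).comp
    (MvPolynomial.mapAlgHom (f : S →ₐ[K] S))

theorem substHom_C (f : S ≃ₐ[K] S) {ι : Type} (v : ι → MvPolynomial ι S) (s : S) :
    substHom f v (MvPolynomial.C s) = MvPolynomial.C (f s) := by
  simp [substHom, MvPolynomial.algebraMap_eq]

theorem substHom_X (f : S ≃ₐ[K] S) {ι : Type} (v : ι → MvPolynomial ι S) (i : ι) :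
    substHom f v (MvPolynomial.X i) = v i := by
  simp [substHom]

theorem algHom_ext_CX {ι : Type} {A : Type*} [CommRing A] [Algebra K A]
    {f g : MvPolynomial ι S →ₐ[K] A}
    (hC : ∀ s, f (MvPolynomial.C s) = g (MvPolynomial.C s))
    (hX : ∀ i, f (MvPolynomial.X i) = g (MvPolynomial.X i)) : f = g :=
  AlgHom.coe_ringHom_injective (MvPolynomial.ringHom_ext hC hX)

/-- Auxiliary construction: an action of `G` on `S[W_i]`, from the images of the variables. -/
noncomputable def actOfVars (β : G →* (S ≃ₐ[K] S)) {ι : Type} (v : G → ι → MvPolynomial ι S)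
    (h1 : ∀ i, v 1 i = MvPolynomial.X i)
    (hmul : ∀ g h i, v (g * h) i = substHom (β g) (v g) (v h i)) :
    G →* (MvPolynomial ι S ≃ₐ[K] MvPolynomial ι S) where
  toFun g := AlgEquiv.ofAlgHom (substHom (β g) (v g)) (substHom (β g⁻¹) (v g⁻¹))
    (algHom_ext_CX
      (fun s => by
        rw [AlgHom.comp_apply, substHom_C, substHom_C, ← AlgEquiv.mul_apply, ← map_mul]; simp)
      (fun i => by rw [AlgHom.comp_apply, substHom_X, ← hmul, mul_inv_cancel, h1]; rfl))
    (algHom_ext_CX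
      (fun s => by
        rw [AlgHom.comp_apply, substHom_C, substHom_C, ← AlgEquiv.mul_apply, ← map_mul]; simp)
      (fun i => by rw [AlgHom.comp_apply, substHom_X, ← hmul, inv_mul_cancel, h1]; rfl))
  map_one' := AlgEquiv.ext fun p => by
    have h : substHom (β 1) (v 1) = AlgHom.id K (MvPolynomial ι S) :=
      algHom_ext_CX (fun s => by rw [substHom_C, map_one]; rfl)
        (fun i => by rw [substHom_X, h1]; rfl)
    exact AlgHom.congr_fun h p
  map_mul' g h := AlgEquiv.ext fun p => by
    have h : substHom (β (g * h)) (v (g * h)) =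
        (substHom (β g) (v g)).comp (substHom (β h) (v h)) :=
      algHom_ext_CX
        (fun s => by rw [AlgHom.comp_apply, substHom_C, substHom_C, substHom_C, map_mul]; rfl)
        (fun i => by rw [AlgHom.comp_apply, substHom_X, substHom_X, hmul])
    exact AlgHom.congr_fun h p

theorem actOfVars_apply (β : G →* (S ≃ₐ[K] S)) {ι : Type} (v : G → ι → MvPolynomial ι S)
    (h1 : ∀ i, v 1 i = MvPolynomial.X i)
    (hmul : ∀ g h i, v (g * h) i = substHom (β g) (v g) (v h i)) (g : G)
    (p : MvPolynomial ι S) : actOfVars β v h1 hmul g p = substHom (β g) (v g) p := by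
  unfold actOfVars
  rfl

theorem actOfVars_C (β : G →* (S ≃ₐ[K] S)) {ι : Type} (v : G → ι → MvPolynomial ι S)
    (h1 : ∀ i, v 1 i = MvPolynomial.X i)
    (hmul : ∀ g h i, v (g * h) i = substHom (β g) (v g) (v h i)) (g : G)
    (s : S) : actOfVars β v h1 hmul g (MvPolynomial.C s) = MvPolynomial.C (β g s) := by
  rw [actOfVars_apply, substHom_C]

theorem actOfVars_X (β : G →* (S ≃ₐ[K] S)) {ι : Type} (v : G → ι → MvPolynomial ι S)
    (h1 : ∀ i, v 1 i = MvPolynomial.X i)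
    (hmul : ∀ g h i, v (g * h) i = substHom (β g) (v g) (v h i)) (g : G)
    (i : ι) : actOfVars β v h1 hmul g (MvPolynomial.X i) = v g i := by
  rw [actOfVars_apply, substHom_X]

/-- The product action `β × ρ` of `G` on `Y × 𝔸^ι` for a linear representation `ρ`: in terms of
points `g (y, v) = (g y, ρ(g) v)`, so on coordinates `g W_i = ∑ j, ρ(g⁻¹)_{ij} W_j`. -/
noncomputable def prodAction (β : G →* (S ≃ₐ[K] S)) {ι : Type} [Fintype ι] [DecidableEq ι]
    (ρ : G →* GL ι K) : ProductAction β ι where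
  act := actOfVars β
    (fun g i => ∑ j, ((ρ g⁻¹ : GL ι K) : Matrix ι ι K) i j • MvPolynomial.X j)
    (fun i => by simp [Matrix.one_apply])
    (fun g h i => by
      simp only [map_sum, map_smul, substHom_X, mul_inv_rev, map_mul, Units.val_mul,
        Matrix.mul_apply, Finset.sum_smul, Finset.smul_sum, smul_smul]
      exact Finset.sum_comm)
  compat := fun g s => actOfVars_C _ _ _ _ _ _
  linear := fun g i => by
    rw [actOfVars_X]
    exact Submodule.sum_mem _ fun j _ =>
      Submodule.smul_mem _ _ (Submodule.subset_span ⟨j, rfl⟩)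

/-- The diagonal action on `(Y × 𝔸^ι) ×_Y (Y × 𝔸^κ) = Y × 𝔸^ι × 𝔸^κ` of two product actions. -/
noncomputable def ProductAction.sum {β : G →* (S ≃ₐ[K] S)} {ι κ : Type}
    (σ : ProductAction β ι) (τ : ProductAction β κ) : ProductAction β (ι ⊕ κ) where
  act := actOfVars β
    (fun g => Sum.elim
      (fun i => MvPolynomial.rename Sum.inl (σ.act g (MvPolynomial.X i)))
      (fun i => MvPolynomial.rename Sum.inr (τ.act g (MvPolynomial.X i))))
    (fun i => by rcases i with i | i <;> simp)
    (fun g h i => by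
      set v : G → ι ⊕ κ → MvPolynomial (ι ⊕ κ) S := fun g => Sum.elim
        (fun i => MvPolynomial.rename Sum.inl (σ.act g (MvPolynomial.X i)))
        (fun i => MvPolynomial.rename Sum.inr (τ.act g (MvPolynomial.X i)))
      rcases i with i | i
      · have key : (substHom (β g) (v g)).comp ((MvPolynomial.rename Sum.inl :
              MvPolynomial ι S →ₐ[S] MvPolynomial (ι ⊕ κ) S).restrictScalars K) =
            ((MvPolynomial.rename Sum.inl :
              MvPolynomial ι S →ₐ[S] MvPolynomial (ι ⊕ κ) S).restrictScalars K).comp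
              (σ.act g : MvPolynomial ι S →ₐ[K] MvPolynomial ι S) :=
          algHom_ext_CX (fun s => by simp [σ.compat, substHom_C])
            (fun i => by simp [substHom_X, v])
        have h2 := AlgHom.congr_fun key (σ.act h (MvPolynomial.X i))
        simpa [v] using h2.symm
      · have key : (substHom (β g) (v g)).comp ((MvPolynomial.rename Sum.inr :
              MvPolynomial κ S →ₐ[S] MvPolynomial (ι ⊕ κ) S).restrictScalars K) =
            ((MvPolynomial.rename Sum.inr :
              MvPolynomial κ S →ₐ[S] MvPolynomial (ι ⊕ κ) S).restrictScalars K).comp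
              (τ.act g : MvPolynomial κ S →ₐ[K] MvPolynomial κ S) :=
          algHom_ext_CX (fun s => by simp [τ.compat, substHom_C])
            (fun i => by simp [substHom_X, v])
        have h2 := AlgHom.congr_fun key (τ.act h (MvPolynomial.X i))
        simpa [v] using h2.symm)
  compat := fun g s => actOfVars_C _ _ _ _ _ _
  linear := fun g i => by
    rw [actOfVars_X]
    rcases i with i | i
    · have h := Submodule.mem_map_of_mem (f := ((MvPolynomial.rename Sum.inl :
        MvPolynomial ι S →ₐ[S] MvPolynomial (ι ⊕ κ) S).restrictScalars K).toLinearMap)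
        (σ.linear g i)
      rw [Submodule.map_span] at h
      refine Submodule.span_mono ?_ h
      rintro _ ⟨_, ⟨j, rfl⟩, rfl⟩
      exact ⟨Sum.inl j, by simp⟩
    · have h := Submodule.mem_map_of_mem (f := ((MvPolynomial.rename Sum.inr :
        MvPolynomial κ S →ₐ[S] MvPolynomial (ι ⊕ κ) S).restrictScalars K).toLinearMap)
        (τ.linear g i)
      rw [Submodule.map_span] at h
      refine Submodule.span_mono ?_ h
      rintro _ ⟨_, ⟨j, rfl⟩, rfl⟩
      exact ⟨Sum.inr j, by simp⟩

theorem ProductAction.sum_act_inl {β : G →* (S ≃ₐ[K] S)} {ι κ : Type}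
    (σ : ProductAction β ι) (τ : ProductAction β κ) (g : G) (p : MvPolynomial ι S) :
    (σ.sum τ).act g (MvPolynomial.rename Sum.inl p) =
      MvPolynomial.rename Sum.inl (σ.act g p) := by
  induction p using MvPolynomial.induction_on with
  | C s => simp [ProductAction.compat]
  | add p q hp hq => simp [hp, hq]
  | mul_X p i hp =>
    rw [map_mul, map_mul, hp, map_mul, map_mul]
    simp [ProductAction.sum, actOfVars_X]

theorem ProductAction.sum_act_inr {β : G →* (S ≃ₐ[K] S)} {ι κ : Type}
    (σ : ProductAction β ι) (τ : ProductAction β κ) (g : G) (p : MvPolynomial κ S) :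
    (σ.sum τ).act g (MvPolynomial.rename Sum.inr p) =
      MvPolynomial.rename Sum.inr (τ.act g p) := by
  induction p using MvPolynomial.induction_on with
  | C s => simp [ProductAction.compat]
  | add p q hp hq => simp [hp, hq]
  | mul_X p i hp =>
    rw [map_mul, map_mul, hp, map_mul, map_mul]
    simp [ProductAction.sum, actOfVars_X]

/-- `φ` and `ψ` are comorphisms of an isomorphism of trivial vector bundles
`Y × 𝔸^ι → Y × 𝔸^ι` (linear in the second component, with coefficients in `S`) over an
automorphism of `Y`; both are `G`-equivariant, the bundle isomorphism with respect to the
product actions `σ` and `τ`. -/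
structure IsBundleIso {β : G →* (S ≃ₐ[K] S)} {ι : Type} (φ : S ≃ₐ[K] S)
    (ψ : MvPolynomial ι S ≃ₐ[K] MvPolynomial ι S) (σ τ : ProductAction β ι) : Prop where
  base_equivariant : ∀ g s, φ (β g s) = β g (φ s)
  over_base : ∀ s, ψ (MvPolynomial.C s) = MvPolynomial.C (φ s)
  linear : ∀ i, ψ (MvPolynomial.X i) ∈
    Submodule.span S (Set.range (MvPolynomial.X : ι → MvPolynomial ι S))
  linear_symm : ∀ i, ψ.symm (MvPolynomial.X i) ∈
    Submodule.span S (Set.range (MvPolynomial.X : ι → MvPolynomial ι S))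
  equivariant : ∀ g p, ψ (σ.act g p) = τ.act g (ψ p)

/-- A `K`-automorphism of `S[W_i]` over the identity of `S` that maps the variables to linear
forms maps linear forms to linear forms. -/
theorem map_mem_span {ι : Type} (ψ : MvPolynomial ι S ≃ₐ[K] MvPolynomial ι S)
    (hC : ∀ s, ψ (MvPolynomial.C s) = MvPolynomial.C s)
    (hX : ∀ i, ψ (MvPolynomial.X i) ∈
      Submodule.span S (Set.range (MvPolynomial.X : ι → MvPolynomial ι S)))
    {p : MvPolynomial ι S}
    (hp : p ∈ Submodule.span S (Set.range (MvPolynomial.X : ι → MvPolynomial ι S))) :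
    ψ p ∈ Submodule.span S (Set.range (MvPolynomial.X : ι → MvPolynomial ι S)) := by
  induction hp using Submodule.span_induction with
  | mem x hx => obtain ⟨i, rfl⟩ := hx; exact hX i
  | zero => simp
  | add x y _ _ hx hy => rw [map_add]; exact Submodule.add_mem _ hx hy
  | smul a x _ hx =>
    rw [MvPolynomial.smul_eq_C_mul, map_mul, hC, ← MvPolynomial.smul_eq_C_mul]
    exact Submodule.smul_mem _ _ hx

/-- Equivalence of linear representations `G → GL_m(K)`. -/
def repSetoid (K : Type v) [Field K] (G : Type w) [Group G] (m : ℕ) :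
    Setoid (G →* GL (Fin m) K) where
  r ρ ρ' := ∃ P : GL (Fin m) K, ∀ g, ρ' g = P * ρ g * P⁻¹
  iseqv :=
    { refl := fun ρ => ⟨1, fun g => by simp⟩
      symm := by
        rintro ρ ρ' ⟨P, h⟩
        exact ⟨P⁻¹, fun g => by rw [h g]; group⟩
      trans := by
        rintro ρ ρ' ρ'' ⟨P, h⟩ ⟨Q, h'⟩
        exact ⟨Q * P, fun g => by rw [h' g, h g]; group⟩ }

/-- Equivalence classes of linear representations of `G` of dimension `m`. -/
abbrev RepClass (K : Type v) [Field K] (G : Type w) [Group G] (m : ℕ) : Type (max v w) :=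
  Quotient (repSetoid K G m)

/-- Two product actions on `Y × 𝔸^m` are equivalent if they are isomorphic as `G`-equivariant
vector bundles over `Y`. -/
def productActionSetoid (β : G →* (S ≃ₐ[K] S)) (m : ℕ) :
    Setoid (ProductAction β (Fin m)) where
  r σ τ := ∃ ψ, IsBundleIso AlgEquiv.refl ψ σ τ
  iseqv :=
    { refl := fun σ => ⟨AlgEquiv.refl,
        { base_equivariant := fun _ _ => rfl
          over_base := fun _ => rfl
          linear := fun i => Submodule.subset_span ⟨i, rfl⟩
          linear_symm := fun i => Submodule.subset_span ⟨i, rfl⟩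
          equivariant := fun _ _ => rfl }⟩
      symm := by
        rintro σ τ ⟨ψ, h⟩
        exact ⟨ψ.symm,
          { base_equivariant := fun _ _ => rfl
            over_base := fun s => by
              rw [AlgEquiv.symm_apply_eq]; exact (h.over_base s).symm
            linear := h.linear_symm
            linear_symm := h.linear
            equivariant := fun g p => by
              rw [AlgEquiv.symm_apply_eq, h.equivariant, AlgEquiv.apply_symm_apply] }⟩
      trans := by
        rintro σ τ υ ⟨ψ, h⟩ ⟨ψ', h'⟩
        exact ⟨ψ.trans ψ',
          { base_equivariant := fun _ _ => rfl
            over_base := fun s => by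
              exact (congrArg ψ' (h.over_base s)).trans (h'.over_base s)
            linear := fun i => map_mem_span ψ' h'.over_base h'.linear (h.linear i)
            linear_symm := fun i => map_mem_span ψ.symm
              (fun s => by rw [AlgEquiv.symm_apply_eq]; exact (h.over_base s).symm)
              h.linear_symm (h'.linear_symm i)
            equivariant := fun g p => by
              rw [AlgEquiv.trans_apply, h.equivariant, h'.equivariant, AlgEquiv.trans_apply] }⟩ }

/-- Equivalence classes of product actions of `G` on `Y × 𝔸^m`. -/
abbrev ProductActionClass (β : G →* (S ≃ₐ[K] S)) (m : ℕ) : Type (max u w) :=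
  Quotient (productActionSetoid β m)

/-- The invariant ring `R = S^G`. -/
def invariantRing (β : G →* (S ≃ₐ[K] S)) : Subalgebra K S where
  carrier := {s | ∀ g, β g s = s}
  mul_mem' := fun ha hb g => by rw [map_mul, ha g, hb g]
  add_mem' := fun ha hb g => by rw [map_add, ha g, hb g]
  algebraMap_mem' := fun k g => (β g).commutes k

/-- The invariant algebra `B = S[W_i]^G` of a product action, as an algebra over `R = S^G`. -/
noncomputable def quotAlg {β : G →* (S ≃ₐ[K] S)} {ι : Type} (σ : ProductAction β ι) :
    Subalgebra (invariantRing β) (MvPolynomial ι S) where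
  carrier := {p | ∀ g, σ.act g p = p}
  mul_mem' := fun ha hb g => by rw [map_mul, ha g, hb g]
  add_mem' := fun ha hb g => by rw [map_add, ha g, hb g]
  algebraMap_mem' := fun r g => by
    change σ.act g (MvPolynomial.C (r : S)) = MvPolynomial.C (r : S)
    rw [σ.compat, r.2 g]

/-- The quotient scheme `X = Y / G = Spec S^G`. -/
noncomputable def baseQuot (β : G →* (S ≃ₐ[K] S)) : Scheme.{u} :=
  Spec (CommRingCat.of (invariantRing β))

/-- The quotient scheme `(Y × 𝔸^ι) / G → X` of a product action, as a scheme over `X`. -/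
noncomputable def quotScheme {β : G →* (S ≃ₐ[K] S)} {ι : Type} (σ : ProductAction β ι) :
    Over (baseQuot β) :=
  Over.mk (Y := Spec (CommRingCat.of (quotAlg σ)))
    (Spec.map (CommRingCat.ofHom (algebraMap (invariantRing β) (quotAlg σ))))

/-- The schemes over `X` which are (up to isomorphism over `X`) of the form `(Y × 𝔸^m) / G → X`
for a product action of `G` on `Y × 𝔸^m`. -/
def QuotObj (β : G →* (S ≃ₐ[K] S)) (m : ℕ) : Type (u + 1) :=
  {Z : Over (baseQuot β) // ∃ σ : ProductAction β (Fin m), Nonempty (Z ≅ quotScheme σ)}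

/-- The quotient scheme of a product action on `Y × 𝔸^m`. -/
noncomputable def quotObj {β : G →* (S ≃ₐ[K] S)} {m : ℕ} (σ : ProductAction β (Fin m)) :
    QuotObj β m :=
  ⟨quotScheme σ, σ, ⟨Iso.refl _⟩⟩

/-- Isomorphism of quotient schemes as schemes over `X`. -/
def quotSetoid (β : G →* (S ≃ₐ[K] S)) (m : ℕ) : Setoid (QuotObj β m) where
  r Z Z' := Nonempty (Z.1 ≅ Z'.1)
  iseqv :=
    { refl := fun _ => ⟨Iso.refl _⟩
      symm := fun ⟨e⟩ => ⟨e.symm⟩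
      trans := fun ⟨e⟩ ⟨f⟩ => ⟨e ≪≫ f⟩ }

/-- Isomorphism classes over `X` of quotient schemes `(Y × 𝔸^m) / G → X`. -/
abbrev QuotClass (β : G →* (S ≃ₐ[K] S)) (m : ℕ) : Type (u + 1) :=
  Quotient (quotSetoid β m)

/-- The map of invariant algebras induced by a `G`-equivariant homomorphism over `S`. -/
noncomputable def quotMap {β : G →* (S ≃ₐ[K] S)} {ι κ : Type} (σ : ProductAction β ι)
    (τ : ProductAction β κ) (f : MvPolynomial ι S →ₐ[S] MvPolynomial κ S)
    (hf : ∀ g p, τ.act g (f p) = f (σ.act g p)) : quotAlg σ →ₐ[invariantRing β] quotAlg τ :=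
  ((f.restrictScalars (invariantRing β)).comp (quotAlg σ).val).codRestrict (quotAlg τ)
    (fun p g => by
      change τ.act g (f (p : MvPolynomial ι S)) = f (p : MvPolynomial ι S)
      rw [hf, p.2 g])

/-- The comorphism of the projection `(Y × 𝔸^ι × 𝔸^κ) / G → (Y × 𝔸^ι) / G`. -/
noncomputable def prL {β : G →* (S ≃ₐ[K] S)} {ι κ : Type} (σ : ProductAction β ι)
    (τ : ProductAction β κ) : quotAlg σ →ₐ[invariantRing β] quotAlg (σ.sum τ) :=
  quotMap σ (σ.sum τ) (MvPolynomial.rename Sum.inl) (σ.sum_act_inl τ)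

/-- The comorphism of the projection `(Y × 𝔸^ι × 𝔸^κ) / G → (Y × 𝔸^κ) / G`. -/
noncomputable def prR {β : G →* (S ≃ₐ[K] S)} {ι κ : Type} (σ : ProductAction β ι)
    (τ : ProductAction β κ) : quotAlg τ →ₐ[invariantRing β] quotAlg (σ.sum τ) :=
  quotMap τ (σ.sum τ) (MvPolynomial.rename Sum.inr) (σ.sum_act_inr τ)

theorem equivariant_of_X {β : G →* (S ≃ₐ[K] S)} {ι κ : Type} (σ : ProductAction β ι)
    (τ : ProductAction β κ) (f : MvPolynomial ι S →ₐ[S] MvPolynomial κ S)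
    (h : ∀ g i, τ.act g (f (MvPolynomial.X i)) = f (σ.act g (MvPolynomial.X i)))
    (g : G) (p : MvPolynomial ι S) : τ.act g (f p) = f (σ.act g p) := by
  have hC : ∀ s, f (MvPolynomial.C s) = MvPolynomial.C s := fun s => f.commutes s
  induction p using MvPolynomial.induction_on with
  | C s => rw [hC, τ.compat, σ.compat, hC]
  | add p q hp hq => simp only [map_add, hp, hq]
  | mul_X p i hp => simp only [map_mul, hp, h]

/-- The comorphism of the addition `(Y × 𝔸^ι × 𝔸^ι) / G → (Y × 𝔸^ι) / G`, induced by the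
addition `W_i ↦ W_i + W_i'` of the vector bundle `Y × 𝔸^ι`. -/
noncomputable def coadd {β : G →* (S ≃ₐ[K] S)} {ι : Type} (σ : ProductAction β ι) :
    quotAlg σ →ₐ[invariantRing β] quotAlg (σ.sum σ) :=
  quotMap σ (σ.sum σ)
    (MvPolynomial.aeval fun i => MvPolynomial.X (Sum.inl i) + MvPolynomial.X (Sum.inr i))
    (equivariant_of_X σ (σ.sum σ) _ fun g i => by
      have hl := σ.sum_act_inl σ g (MvPolynomial.X i)
      have hr := σ.sum_act_inr σ g (MvPolynomial.X i)
      rw [MvPolynomial.rename_X] at hl hr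
      rw [MvPolynomial.aeval_X, map_add, hl, hr]
      have hlin := σ.linear g i
      generalize σ.act g (MvPolynomial.X i) = q at hlin ⊢
      induction hlin using Submodule.span_induction with
      | mem x hx => obtain ⟨j, rfl⟩ := hx; simp
      | zero => simp
      | add x y _ _ hx hy => simp only [map_add, ← hx, ← hy]; ring
      | smul a x _ hx =>
        have e : a • x = MvPolynomial.C (algebraMap K S a) * x := by
          rw [Algebra.smul_def, IsScalarTower.algebraMap_apply K S (MvPolynomial ι S),
            MvPolynomial.algebraMap_eq]
        rw [e, map_mul, map_mul, map_mul, ← hx]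
        simp [mul_add])

/-- The trivial action of `G` on the line, so that `(Y × 𝔸^ι × 𝔸^1) / G = (Y × 𝔸^ι) / G × 𝔸^1`. -/
noncomputable def lineAction (β : G →* (S ≃ₐ[K] S)) : ProductAction β Unit :=
  prodAction β (1 : G →* GL Unit K)

/-- The comorphism of the scalar multiplication `𝔸^1 × (Y × 𝔸^ι) / G → (Y × 𝔸^ι) / G`, induced
by the scalar multiplication `W_i ↦ T W_i` of the vector bundle `Y × 𝔸^ι`. -/
noncomputable def cosmul {β : G →* (S ≃ₐ[K] S)} {ι : Type} (σ : ProductAction β ι) :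
    quotAlg σ →ₐ[invariantRing β] quotAlg (σ.sum (lineAction β)) :=
  quotMap σ (σ.sum (lineAction β))
    (MvPolynomial.aeval fun i => MvPolynomial.X (Sum.inr ()) * MvPolynomial.X (Sum.inl i))
    (equivariant_of_X σ (σ.sum (lineAction β)) _ fun g i => by
      have hl := σ.sum_act_inl (lineAction β) g (MvPolynomial.X i)
      have hr := σ.sum_act_inr (lineAction β) g (MvPolynomial.X ())
      have hT : (lineAction β).act g (MvPolynomial.X ()) = MvPolynomial.X () := by
        simp [lineAction, prodAction, actOfVars_X]
      rw [hT] at hr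
      rw [MvPolynomial.rename_X] at hl hr
      rw [MvPolynomial.aeval_X, map_mul, hl, hr]
      have hlin := σ.linear g i
      generalize σ.act g (MvPolynomial.X i) = q at hlin ⊢
      induction hlin using Submodule.span_induction with
      | mem x hx => obtain ⟨j, rfl⟩ := hx; simp
      | zero => simp
      | add x y _ _ hx hy => simp only [map_add, ← hx, ← hy]; ring
      | smul a x _ hx =>
        have e : a • x = MvPolynomial.C (algebraMap K S a) * x := by
          rw [Algebra.smul_def, IsScalarTower.algebraMap_apply K S (MvPolynomial ι S),
            MvPolynomial.algebraMap_eq]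
        rw [e, map_mul, map_mul, ← hx]
        simp
        ring)

/-- `e` is the comorphism of a linear morphism `Z_τ → Z_σ` over `X` between the quotient schemes
`Z_σ = (Y × 𝔸^ι) / σ` and `Z_τ = (Y × 𝔸^ι) / τ`, regarded as module schemes up to normalization:
it commutes with the scalar multiplications `𝔸^1 × Z → Z`, and it lifts to a morphism between
`(Y × 𝔸^ι × 𝔸^ι) / G` (the normalizations of `Z ×_X Z`) which commutes with the additions. -/
def IsLinearComorphism {β : G →* (S ≃ₐ[K] S)} {ι : Type} {σ τ : ProductAction β ι}
    (e : quotAlg σ →ₐ[invariantRing β] quotAlg τ) : Prop :=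
  (∃ E : quotAlg (σ.sum (lineAction β)) →ₐ[invariantRing β] quotAlg (τ.sum (lineAction β)),
    E.comp (prL σ (lineAction β)) = (prL τ (lineAction β)).comp e ∧
    E.comp (prR σ (lineAction β)) = prR τ (lineAction β) ∧
    E.comp (cosmul σ) = (cosmul τ).comp e) ∧
  (∃ E : quotAlg (σ.sum σ) →ₐ[invariantRing β] quotAlg (τ.sum τ),
    E.comp (prL σ σ) = (prL τ τ).comp e ∧
    E.comp (prR σ σ) = (prR τ τ).comp e ∧
    E.comp (coadd σ) = (coadd τ).comp e)

/-- The quotient schemes of `σ` and `τ` are linearly isomorphic over `X`, i.e. isomorphic as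
module schemes up to normalization. -/
def LinearlyIsomorphic {β : G →* (S ≃ₐ[K] S)} {ι : Type} (σ τ : ProductAction β ι) : Prop :=
  ∃ e : quotAlg σ ≃ₐ[invariantRing β] quotAlg τ,
    IsLinearComorphism (e : quotAlg σ →ₐ[invariantRing β] quotAlg τ) ∧
    IsLinearComorphism (e.symm : quotAlg τ →ₐ[invariantRing β] quotAlg σ)

/-- The action which the product action `σ` induces on the fiber `𝔸^ι` of `Y × 𝔸^ι → Y` over the
`K`-point `ε` is the linear action given by the representation `ρ`. -/
def IsFiberRep {β : G →* (S ≃ₐ[K] S)} {ι : Type} [Fintype ι] [DecidableEq ι] (ε : S →ₐ[K] K)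
    (σ : ProductAction β ι) (ρ : G →* GL ι K) : Prop :=
  ∀ g p, MvPolynomial.map (ε : S →+* K) (σ.act g p) =
    (prodAction (1 : G →* (K ≃ₐ[K] K)) ρ).act g (MvPolynomial.map (ε : S →+* K) p)

end Actions

/-- `Spec C → Spec A` is the normalization of the (irreducible) scheme `Spec A`: `C` is a normal
domain, integral over the reduction of `A` and with the same field of fractions. -/
structure IsNormalization {A C : Type*} [CommRing A] [CommRing C] (f : A →+* C) : Prop where
  isDomain : IsDomain C
  isIntegrallyClosed : IsIntegrallyClosed C
  isIntegral : f.IsIntegral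
  ker_eq : RingHom.ker f = nilradical A
  fraction : ∀ c, ∃ a b, f b ≠ 0 ∧ f b * c = f a

/-- `Y × 𝔸^ι` with the product action `τ` is the normalization of the pull-back
`Y ×_X Spec A = Spec (S ⊗_R A)` of the `X`-scheme `Spec A`, over `Y` and `G`-equivariantly,
where `G` acts on the pull-back through the first factor. -/
def IsNormalizedPullback {K : Type v} [Field K] {G : Type w} [Group G] {S : Type u} [CommRing S]
    [Algebra K S] {β : G →* (S ≃ₐ[K] S)} {ι : Type} (τ : ProductAction β ι)
    (A : Type u) [CommRing A] [Algebra (invariantRing β) A] : Prop :=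
  ∃ ν : S ⊗[invariantRing β] A →ₐ[S] MvPolynomial ι S,
    (∀ g s a, ν (β g s ⊗ₜ[invariantRing β] a) = τ.act g (ν (s ⊗ₜ[invariantRing β] a))) ∧
    IsNormalization (ν : S ⊗[invariantRing β] A →+* MvPolynomial ι S)

end QuotientCorrespondence

open QuotientCorrespondence

/-! A product action has its linear coefficients in the field `K`, so it is literally `β × ρ` for a
matrix representation `ρ` (`exists_eq_prodAction`), and restricting it to the fiber over the fixed
point gives back `ρ`.

Everything then rests on a cycle of implications between two product actions: isomorphic quotients
over `X` ⇒ one normalizes the pull-back of the other's quotient ⇒ equivalent as equivariant bundles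
⇒ linearly isomorphic quotients ⇒ isomorphic quotients.

The first implication needs `isNormalization_pullbackMap`: the map `S ⊗ S[W]^G → S[W]` is a
normalization. It is integral because of orbit polynomials, its kernel is nil by a norm argument,
and it induces the full field of fractions because `G` acts faithfully.

For the second, uniqueness of normalization produces an equivariant isomorphism of `Y × 𝔸^m` over
`Y`, with no reason to be linear. Its derivative at the origin of the fiber over the fixed point
intertwines the two representations (`rep_equiv_of_equivariant`), and an intertwiner is a linear
change of coordinates, hence a bundle isomorphism. The argument also allows an isomorphism over an
automorphism of `Y`. The last two implications are formal. -/

namespace QuotientCorrespondence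

/-! ### Product actions as representations, and linearization at the fixed point. -/

section Representations

variable {K : Type v} [Field K] {G : Type w} [Group G] {S : Type u} [CommRing S] [Algebra K S]

theorem ProductAction.ext_act {β : G →* (S ≃ₐ[K] S)} {ι : Type} {σ τ : ProductAction β ι}
    (h : ∀ g i, σ.act g (MvPolynomial.X i) = τ.act g (MvPolynomial.X i)) : σ = τ := by
  have key : σ.act = τ.act := by
    refine MonoidHom.ext fun g => AlgEquiv.ext fun p => ?_
    have e : (σ.act g : MvPolynomial ι S →ₐ[K] MvPolynomial ι S) = τ.act g :=
      algHom_ext_CX (fun s => by simp [σ.compat, τ.compat]) (fun i => by simp [h])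
    exact AlgHom.congr_fun e p
  cases σ
  cases τ
  cases key
  rfl

theorem ProductAction.act_mul_apply {β : G →* (S ≃ₐ[K] S)} {ι : Type} (σ : ProductAction β ι)
    (g h : G) (p : MvPolynomial ι S) : σ.act (g * h) p = σ.act g (σ.act h p) := by
  rw [map_mul, AlgEquiv.mul_apply]

variable {ι : Type} [Fintype ι]

/-- The `K`-linear change of coordinates of `S[W_i]` with a given matrix. -/
noncomputable def linSubst (S : Type u) [CommRing S] [Algebra K S] (P : Matrix ι ι K) :
    MvPolynomial ι S →ₐ[S] MvPolynomial ι S :=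
  MvPolynomial.aeval fun i => ∑ j, P i j • MvPolynomial.X j

theorem linSubst_X (P : Matrix ι ι K) (i : ι) :
    linSubst S P (MvPolynomial.X i) = ∑ j, P i j • MvPolynomial.X j :=
  MvPolynomial.aeval_X _ _

theorem linSubst_comp (P Q : Matrix ι ι K) :
    (linSubst S P).comp (linSubst S Q) = linSubst S (Q * P) := by
  refine MvPolynomial.algHom_ext fun i => ?_
  rw [AlgHom.comp_apply, linSubst_X, linSubst_X, map_sum]
  simp only [AlgHom.map_smul_of_tower, linSubst_X, Matrix.mul_apply, Finset.sum_smul,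
    Finset.smul_sum, smul_smul]
  exact Finset.sum_comm

variable [DecidableEq ι]

theorem prodAction_act_X (β : G →* (S ≃ₐ[K] S)) (ρ : G →* GL ι K) (g : G) (i : ι) :
    (prodAction β ρ).act g (MvPolynomial.X i) =
      ∑ j, ((ρ g⁻¹ : GL ι K) : Matrix ι ι K) i j • MvPolynomial.X j := by
  simp only [prodAction, actOfVars_X]

theorem coeff_sum_smul_X (c : ι → K) (k : ι) :
    MvPolynomial.coeff (Finsupp.single k 1) (∑ j, c j • (MvPolynomial.X j : MvPolynomial ι S)) =
      algebraMap K S (c k) := by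
  rw [MvPolynomial.coeff_sum, Finset.sum_eq_single k]
  · rw [MvPolynomial.coeff_smul, MvPolynomial.coeff_X, Algebra.smul_def, if_pos rfl, mul_one]
  · intro j _ hj
    rw [MvPolynomial.coeff_smul, MvPolynomial.coeff_X, if_neg, smul_zero]
    intro h
    exact hj (Finsupp.single_left_injective one_ne_zero h)
  · simp

/-- Every product action is of the form `β × ρ`. -/
theorem exists_eq_prodAction [Nontrivial S] (β : G →* (S ≃ₐ[K] S)) (σ : ProductAction β ι) :
    ∃ ρ : G →* GL ι K, σ = prodAction β ρ := by
  have h1 : ∀ g i, ∃ c : ι → K, ∑ j, c j • MvPolynomial.X j = σ.act g (MvPolynomial.X i) :=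
    fun g i => (Submodule.mem_span_range_iff_exists_fun K).mp (σ.linear g i)
  choose a ha using h1
  -- The coefficients of a `K`-linear form can be read off in `S`, as `K → S` is injective; so
  -- identities between the forms become identities between the matrices.
  have inj : ∀ c d : ι → K, ∑ j, c j • (MvPolynomial.X j : MvPolynomial ι S) =
      ∑ j, d j • MvPolynomial.X j → c = d := fun c d h => funext fun k =>
    (algebraMap K S).injective (by rw [← coeff_sum_smul_X, h, coeff_sum_smul_X])
  have a_one : ∀ i j, a 1 i j = (1 : Matrix ι ι K) i j := fun i j => by
    have : a 1 i = (1 : Matrix ι ι K) i := inj _ _ (by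
      rw [ha, map_one]
      simp [Matrix.one_apply])
    rw [this]
  have a_mul : ∀ g h i j, a (g * h) i j = ∑ k, a h i k * a g k j := fun g h i j => by
    have : a (g * h) i = fun j => ∑ k, a h i k * a g k j := inj _ _ (by
      rw [ha, σ.act_mul_apply, ← ha h, map_sum]
      simp only [map_smul, ← ha g, Finset.smul_sum, smul_smul, Finset.sum_smul]
      exact Finset.sum_comm)
    rw [this]
  -- By `a_mul`, the matrices `a g` multiply in the reversed order, functions being contravariant;
  -- the inverse turns this into a homomorphism.
  let M : G →* Matrix ι ι K :=
    { toFun := fun g => Matrix.of (a g⁻¹)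
      map_one' := by
        ext i j
        simp [a_one]
      map_mul' := fun g h => by
        ext i j
        simp [a_mul, Matrix.mul_apply] }
  refine ⟨M.toHomUnits, ProductAction.ext_act fun g i => ?_⟩
  rw [prodAction_act_X, ← ha, MonoidHom.coe_toHomUnits]
  simp only [M, MonoidHom.coe_mk, OneHom.coe_mk, inv_inv, Matrix.of_apply]

/-- Evaluation at `ε` absorbs `β` on the coefficients because the point is fixed, and leaves the
matrix entries of `ρ` alone because they lie in `K`. -/
theorem isFiberRep_prodAction {β : G →* (S ≃ₐ[K] S)} {ε : S →ₐ[K] K} (hε : IsFixedPoint β ε)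
    (ρ : G →* GL ι K) : IsFiberRep ε (prodAction β ρ) ρ := by
  intro g p
  induction p using MvPolynomial.induction_on with
  | C s =>
    rw [ProductAction.compat, MvPolynomial.map_C, MvPolynomial.map_C, ProductAction.compat]
    simp [hε g s]
  | add p q hp hq => simp only [map_add, hp, hq]
  | mul_X p i hp =>
    simp only [map_mul, hp, MvPolynomial.map_X, prodAction_act_X, map_sum]
    congr 1
    refine Finset.sum_congr rfl fun j _ => ?_
    simp [Algebra.smul_def, MvPolynomial.algebraMap_apply]

theorem IsFiberRep.unique {β : G →* (S ≃ₐ[K] S)} {ε : S →ₐ[K] K} {σ : ProductAction β ι}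
    {ρ ρ' : G →* GL ι K} (h : IsFiberRep ε σ ρ) (h' : IsFiberRep ε σ ρ') : ρ = ρ' := by
  refine MonoidHom.ext fun g => Units.ext (Matrix.ext fun i j => ?_)
  have e := (h g⁻¹ (MvPolynomial.X i)).symm.trans (h' g⁻¹ (MvPolynomial.X i))
  rw [MvPolynomial.map_X, prodAction_act_X, prodAction_act_X] at e
  have e' := congrArg (MvPolynomial.coeff (Finsupp.single j 1)) e
  rw [coeff_sum_smul_X, coeff_sum_smul_X, inv_inv] at e'
  exact e'

/-- The chain rule. The twist `φ` of the coefficients contributes no term, since the derivatives are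
relative to `S`. -/
theorem pderiv_ringHom_apply (φ : S →+* S) (ψ : MvPolynomial ι S →+* MvPolynomial ι S)
    (hψ : ∀ s, ψ (MvPolynomial.C s) = MvPolynomial.C (φ s)) (k : ι) (p : MvPolynomial ι S) :
    MvPolynomial.pderiv k (ψ p) =
      ∑ j, ψ (MvPolynomial.pderiv j p) * MvPolynomial.pderiv k (ψ (MvPolynomial.X j)) := by
  induction p using MvPolynomial.induction_on with
  | C s => simp [hψ]
  | add p q hp hq => simp only [map_add, hp, hq, add_mul, Finset.sum_add_distrib]
  | mul_X p i hp =>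
    have e : ∀ j, MvPolynomial.pderiv j (p * MvPolynomial.X i) =
        MvPolynomial.pderiv j p * MvPolynomial.X i + p * (if j = i then 1 else 0) := fun j => by
      rw [MvPolynomial.pderiv_mul, MvPolynomial.pderiv_X, Pi.single_apply]
      simp [eq_comm]
    simp only [e, map_mul, map_add, MvPolynomial.pderiv_mul, hp, add_mul, Finset.sum_add_distrib,
      Finset.sum_mul]
    congr 1
    · exact Finset.sum_congr rfl fun j _ => by ring
    · rw [Finset.sum_eq_single i]
      · simp
      · intro j _ hj
        simp [hj]
      · simp

/-- A linear action preserves the zero section. Over a fixed point of `Y` the origin of the fiber is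
therefore a fixed point. -/
theorem constantCoeff_prodAction_act {β : G →* (S ≃ₐ[K] S)} (ρ : G →* GL ι K) (g : G)
    (p : MvPolynomial ι S) : MvPolynomial.constantCoeff ((prodAction β ρ).act g p) =
      β g (MvPolynomial.constantCoeff p) := by
  induction p using MvPolynomial.induction_on with
  | C s => simp [ProductAction.compat]
  | add p q hp hq => simp only [map_add, hp, hq]
  | mul_X p i hp => simp [prodAction_act_X]

/-- The derivative at the origin of the fiber over `ε` of an equivariant, possibly non-linear,
isomorphism `Y × 𝔸^ι → Y × 𝔸^ι` is an equivalence of representations. -/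
theorem rep_equiv_of_equivariant {β : G →* (S ≃ₐ[K] S)} {ε : S →ₐ[K] K} (hε : IsFixedPoint β ε)
    {ρ ρ' : G →* GL ι K} (φ : S ≃ₐ[K] S) (ψ : MvPolynomial ι S ≃ₐ[K] MvPolynomial ι S)
    (hψ : ∀ s, ψ (MvPolynomial.C s) = MvPolynomial.C (φ s))
    (heq : ∀ g p, ψ ((prodAction β ρ).act g p) = (prodAction β ρ').act g (ψ p)) :
    ∃ P : GL ι K, ∀ g, ρ' g = P * ρ g * P⁻¹ := by
  -- `E` is evaluation at the origin of the fiber over `ε`, and `D k` is the `k`-th partial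
  -- derivative there.
  let E : MvPolynomial ι S →ₐ[K] K :=
    ε.comp ((MvPolynomial.aeval (0 : ι → S) : MvPolynomial ι S →ₐ[S] S).restrictScalars K)
  have hE : ∀ p, E p = ε (MvPolynomial.constantCoeff p) := fun p => by
    simp [E]
  let D : ι → MvPolynomial ι S →ₗ[K] K := fun k =>
    E.toLinearMap.comp ((MvPolynomial.pderiv k).toLinearMap.restrictScalars K)
  have hD : ∀ k p, D k p = E (MvPolynomial.pderiv k p) := fun k p => rfl
  have hDX : ∀ k j, D k (MvPolynomial.X j) = (1 : Matrix ι ι K) j k := fun k j => by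
    rw [hD, MvPolynomial.pderiv_X, Pi.single_apply, Matrix.one_apply]
    split_ifs <;> simp
  -- `M` is the Jacobian matrix of `ψ` at that origin. `N` is the Jacobian matrix of the inverse at
  -- the image point, which need not be an origin; hence the `ψ` inside its definition. The chain
  -- rule makes them inverse to each other.
  let M : Matrix ι ι K := Matrix.of fun i k => D k (ψ (MvPolynomial.X i))
  let N : Matrix ι ι K :=
    Matrix.of fun i k => E (ψ (MvPolynomial.pderiv k (ψ.symm (MvPolynomial.X i))))
  have hNM : N * M = 1 := by
    ext i k
    rw [Matrix.mul_apply, ← hDX k i, hD]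
    have h := pderiv_ringHom_apply (φ : S →+* S)
      (ψ : MvPolynomial ι S →+* MvPolynomial ι S) hψ k (ψ.symm (MvPolynomial.X i))
    have h' := congrArg E h
    simp only [RingHom.coe_coe, AlgEquiv.apply_symm_apply, map_sum, map_mul] at h'
    exact h'.symm
  have hMN : M * N = 1 := mul_eq_one_comm.mp hNM
  -- Differentiate the equivariance of `ψ` at the origin. The left side is linear in the `ψ (X j)`;
  -- on the right the chain rule applies, and the derivatives of `ψ (X i)` are again taken at the
  -- origin because `G` fixes it.
  have key : ∀ g, ((ρ g : GL ι K) : Matrix ι ι K) * M = M * ((ρ' g : GL ι K) : Matrix ι ι K) := by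
    intro g
    ext i k
    have h := congrArg (D k) (heq g⁻¹ (MvPolynomial.X i))
    rw [prodAction_act_X, inv_inv] at h
    simp only [map_sum, map_smul, smul_eq_mul] at h
    rw [Matrix.mul_apply, Matrix.mul_apply]
    refine h.trans ?_
    have h2 := pderiv_ringHom_apply (β g⁻¹ : S →+* S)
      ((prodAction β ρ').act g⁻¹ : MvPolynomial ι S →+* MvPolynomial ι S)
      ((prodAction β ρ').compat g⁻¹) k (ψ (MvPolynomial.X i))
    have h3 := congrArg E h2
    simp only [RingHom.coe_coe, map_sum, map_mul] at h3
    rw [hD, h3]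
    refine Finset.sum_congr rfl fun j _ => ?_
    congr 1
    · rw [hE, constantCoeff_prodAction_act, hε]
      exact (hE _).symm
    · change D k _ = _
      rw [prodAction_act_X, inv_inv]
      simp [hDX, Matrix.one_apply]
  let U : GL ι K := ⟨N, M, hNM, hMN⟩
  refine ⟨U, fun g => Units.ext ?_⟩
  change ((ρ' g : GL ι K) : Matrix ι ι K) = N * ((ρ g : GL ι K) : Matrix ι ι K) * M
  rw [Matrix.mul_assoc, key, ← Matrix.mul_assoc, hNM, Matrix.one_mul]

theorem linSubst_one : linSubst S (1 : Matrix ι ι K) = AlgHom.id S _ := by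
  refine MvPolynomial.algHom_ext fun i => ?_
  rw [linSubst_X]
  simp [Matrix.one_apply]

/-- The linear change of coordinates of `S[W_i]` with a given invertible matrix. -/
noncomputable def linEquiv (S : Type u) [CommRing S] [Algebra K S] (P : GL ι K) :
    MvPolynomial ι S ≃ₐ[S] MvPolynomial ι S :=
  AlgEquiv.ofAlgHom (linSubst S (P : Matrix ι ι K)) (linSubst S ((P⁻¹ : GL ι K) : Matrix ι ι K))
    (by rw [linSubst_comp, ← Units.val_mul, inv_mul_cancel, Units.val_one, linSubst_one])
    (by rw [linSubst_comp, ← Units.val_mul, mul_inv_cancel, Units.val_one, linSubst_one])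

theorem linEquiv_X (P : GL ι K) (i : ι) :
    linEquiv S P (MvPolynomial.X i) = ∑ j, (P : Matrix ι ι K) i j • MvPolynomial.X j :=
  linSubst_X _ _

theorem linEquiv_symm (P : GL ι K) : (linEquiv S P).symm = linEquiv S P⁻¹ := by
  refine AlgEquiv.ext fun p => ?_
  change linSubst S ((P⁻¹ : GL ι K) : Matrix ι ι K) p = linSubst S ((P⁻¹ : GL ι K) : Matrix ι ι K) p
  rfl

/-- On the variables this is the matrix identity `P * ρ' g⁻¹ = ρ g⁻¹ * P`; conjugation is by `P⁻¹`
because `P` acts on coordinate functions. -/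
theorem linEquiv_equivariant {β : G →* (S ≃ₐ[K] S)} {ρ ρ' : G →* GL ι K} {P : GL ι K}
    (h : ∀ g, ρ' g = P⁻¹ * ρ g * P) (g : G) (p : MvPolynomial ι S) :
    (prodAction β ρ').act g (linEquiv S P p) = linEquiv S P ((prodAction β ρ).act g p) := by
  refine equivariant_of_X (prodAction β ρ) (prodAction β ρ')
    (linEquiv S P : MvPolynomial ι S →ₐ[S] MvPolynomial ι S) (fun g i => ?_) g p
  have e : P * ρ' g⁻¹ = ρ g⁻¹ * P := by rw [h]; group
  have l : ∀ A B : Matrix ι ι K, ∑ j, A i j • ∑ k, B j k • (MvPolynomial.X k : MvPolynomial ι S) =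
      ∑ k, (A * B) i k • MvPolynomial.X k := fun A B => by
    simp only [Matrix.mul_apply, Finset.sum_smul, Finset.smul_sum, smul_smul]
    exact Finset.sum_comm
  have l2 : ((linEquiv S P : MvPolynomial ι S ≃ₐ[S] MvPolynomial ι S) :
      MvPolynomial ι S →ₐ[S] MvPolynomial ι S) = linSubst S (P : Matrix ι ι K) := rfl
  rw [l2, linSubst_X, prodAction_act_X, map_sum, map_sum]
  simp only [map_smul, AlgHom.map_smul_of_tower, prodAction_act_X, linSubst_X]
  rw [l, l, ← Units.val_mul, ← Units.val_mul, e]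

theorem isBundleIso_linEquiv {β : G →* (S ≃ₐ[K] S)} {ρ ρ' : G →* GL ι K} {P : GL ι K}
    (h : ∀ g, ρ' g = P⁻¹ * ρ g * P) :
    IsBundleIso AlgEquiv.refl ((linEquiv S P).restrictScalars K) (prodAction β ρ)
      (prodAction β ρ') := by
  have mem : ∀ (Q : GL ι K) (i : ι), linEquiv S Q (MvPolynomial.X i) ∈
      Submodule.span S (Set.range (MvPolynomial.X : ι → MvPolynomial ι S)) := fun Q i => by
    rw [linEquiv_X]
    exact Submodule.sum_mem _ fun j _ => by
      rw [← algebraMap_smul S]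
      exact Submodule.smul_mem _ _ (Submodule.subset_span ⟨j, rfl⟩)
  exact
    { base_equivariant := fun _ _ => rfl
      over_base := fun s => (linEquiv S P).commutes s
      linear := mem P
      linear_symm := fun i => by
        have := mem P⁻¹ i
        rwa [← linEquiv_symm] at this
      equivariant := fun g p => (linEquiv_equivariant h g p).symm }

end Representations

/-! ### Uniqueness of the normalization. -/

section Normalization

/-- The universal property of the normalization determines morphisms to domains. -/
theorem IsNormalization.ringHom_ext {A C D : Type*} [CommRing A] [CommRing C] [CommRing D]
    [IsDomain D] {f : A →+* C} (hf : IsNormalization f) {h h' : C →+* D}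
    (hh : h.comp f = h'.comp f) (hker : ∀ b, f b ≠ 0 → h (f b) ≠ 0) : h = h' := by
  refine RingHom.ext fun c => ?_
  obtain ⟨a, b, hb, hc⟩ := hf.fraction c
  have e : ∀ x, h (f x) = h' (f x) := fun x => RingHom.congr_fun hh x
  refine mul_left_cancel₀ (hker b hb) ?_
  rw [← map_mul, hc, e a, e b, ← map_mul, hc]

theorem IsNormalization.apply_eq_zero_iff {A C D : Type*} [CommRing A] [CommRing C] [CommRing D]
    {f : A →+* C} {k : A →+* D} (hf : IsNormalization f) (hk : IsNormalization k) (a : A) :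
    f a = 0 ↔ k a = 0 := by
  rw [← RingHom.mem_ker, ← RingHom.mem_ker, hf.ker_eq, hk.ker_eq]

theorem IsNormalization.apply_eq_iff {A C D : Type*} [CommRing A] [CommRing C] [CommRing D]
    {f : A →+* C} {k : A →+* D} (hf : IsNormalization f) (hk : IsNormalization k) (a b : A) :
    f a = f b ↔ k a = k b := by
  rw [← sub_eq_zero, ← map_sub, hf.apply_eq_zero_iff hk, map_sub, sub_eq_zero]

/-- Write `c = f a / f b`. Since `f` and `k` have the same kernel, an integral equation for this
fraction carries over to `k a / k b`, which then lies in the normal ring `D`. One `d` serves all the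
fractions representing `c`, which makes the assignment compatible with sums and products. -/
theorem IsNormalization.exists_image {A C D : Type*} [CommRing A] [CommRing C] [CommRing D]
    {f : A →+* C} {k : A →+* D} (hf : IsNormalization f) (hk : IsNormalization k) (c : C) :
    ∃ d, ∀ a b, f b * c = f a → k b * d = k a := by
  have := hf.isDomain
  have := hk.isDomain
  have := hk.isIntegrallyClosed
  obtain ⟨a, b, hb, hc⟩ := hf.fraction c
  have hkb : k b ≠ 0 := fun h => hb ((hf.apply_eq_zero_iff hk b).mpr h)
  let k' : A →+* FractionRing D := (algebraMap D (FractionRing D)).comp k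
  have hk'b : k' b ≠ 0 := fun h =>
    hkb ((map_eq_zero_iff _ (IsFractionRing.injective D (FractionRing D))).mp h)
  obtain ⟨p, hp, hpc⟩ := hf.isIntegral c
  -- `scaleRoots` clears the denominators of `p (a / b) = 0`, so that the equation becomes the
  -- vanishing of the image of a single element of `A`.
  have h1 : f ((p.scaleRoots b).eval a) = 0 := by
    rw [← Polynomial.eval₂_id, Polynomial.hom_eval₂, RingHom.comp_id, ← hc,
      Polynomial.scaleRoots_eval₂_mul, hpc, mul_zero]
  have h2 : p.eval₂ k' (k' a / k' b) = 0 := by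
    have h3 : k' ((p.scaleRoots b).eval a) = 0 := by
      change algebraMap D (FractionRing D) (k _) = 0
      rw [(hf.apply_eq_zero_iff hk _).mp h1, map_zero]
    rw [← Polynomial.eval₂_id, Polynomial.hom_eval₂, RingHom.comp_id,
      show k' a = k' b * (k' a / k' b) by field_simp, Polynomial.scaleRoots_eval₂_mul] at h3
    exact (mul_eq_zero.mp h3).resolve_left (pow_ne_zero _ hk'b)
  have h4 : IsIntegral D (k' a / k' b) :=
    ⟨p.map k, hp.map k, by rw [Polynomial.eval₂_map]; exact h2⟩
  obtain ⟨d, hd⟩ := IsIntegrallyClosed.isIntegral_iff.mp h4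
  have hd' : k b * d = k a := by
    apply IsFractionRing.injective D (FractionRing D)
    rw [map_mul, hd]
    exact mul_div_cancel₀ _ hk'b
  refine ⟨d, fun a' b' h => mul_left_cancel₀ hkb ?_⟩
  have h5 : f (b' * a) = f (b * a') := by
    rw [map_mul, map_mul, ← hc, ← h]
    ring
  have h6 := (hf.apply_eq_iff hk _ _).mp h5
  rw [map_mul, map_mul] at h6
  rw [← h6, ← hd']
  ring

theorem IsNormalization.exists_ringHom {A C D : Type*} [CommRing A] [CommRing C] [CommRing D]
    {f : A →+* C} {k : A →+* D} (hf : IsNormalization f) (hk : IsNormalization k) :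
    ∃ e : C →+* D, e.comp f = k := by
  have := hf.isDomain
  have := hk.isDomain
  choose e he using hf.exists_image hk
  have hkb : ∀ b, f b ≠ 0 → k b ≠ 0 := fun b hb h => hb ((hf.apply_eq_zero_iff hk b).mpr h)
  have hef : ∀ a, e (f a) = k a := fun a => by
    have := he (f a) a 1 (by rw [map_one, one_mul])
    rwa [map_one, one_mul] at this
  refine ⟨{ toFun := e, map_one' := ?_, map_mul' := ?_, map_zero' := ?_, map_add' := ?_ },
    RingHom.ext hef⟩
  · rw [← map_one f, hef, map_one]
  · intro c c'
    obtain ⟨a, b, hb, hc⟩ := hf.fraction c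
    obtain ⟨a', b', hb', hc'⟩ := hf.fraction c'
    have h1 := he (c * c') (a * a') (b * b') (by rw [map_mul, map_mul, ← hc, ← hc']; ring)
    refine mul_left_cancel₀ (mul_ne_zero (hkb b hb) (hkb b' hb')) ?_
    rw [← map_mul, h1, map_mul, map_mul, ← he c a b hc, ← he c' a' b' hc']
    ring
  · rw [← map_zero f, hef, map_zero]
  · intro c c'
    obtain ⟨a, b, hb, hc⟩ := hf.fraction c
    obtain ⟨a', b', hb', hc'⟩ := hf.fraction c'
    have h1 := he (c + c') (a * b' + b * a') (b * b') (by
      rw [map_mul, map_add, map_mul, map_mul, ← hc, ← hc']; ring)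
    refine mul_left_cancel₀ (mul_ne_zero (hkb b hb) (hkb b' hb')) ?_
    rw [← map_mul, h1, map_add, map_mul, map_mul, map_mul, ← he c a b hc, ← he c' a' b' hc']
    ring

/-- Normalizations are unique up to isomorphism. -/
theorem IsNormalization.exists_ringEquiv {A C D : Type*} [CommRing A] [CommRing C] [CommRing D]
    {f : A →+* C} {k : A →+* D} (hf : IsNormalization f) (hk : IsNormalization k) :
    ∃ e : C ≃+* D, ∀ a, e (f a) = k a := by
  have := hf.isDomain
  have := hk.isDomain
  obtain ⟨e, he⟩ := hf.exists_ringHom hk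
  obtain ⟨e', he'⟩ := hk.exists_ringHom hf
  have h1 : ∀ a, e (f a) = k a := fun a => RingHom.congr_fun he a
  have h2 : ∀ a, e' (k a) = f a := fun a => RingHom.congr_fun he' a
  refine ⟨RingEquiv.ofRingHom e e' ?_ ?_, h1⟩
  · refine hk.ringHom_ext (RingHom.ext fun a => by simp [h1, h2]) fun b hb => ?_
    simpa [h1, h2] using hb
  · refine hf.ringHom_ext (RingHom.ext fun a => by simp [h1, h2]) fun b hb => ?_
    simpa [h1, h2] using hb

theorem IsNormalization.comp_equiv {A A' C : Type*} [CommRing A] [CommRing A'] [CommRing C]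
    {f : A →+* C} (hf : IsNormalization f) (e : A' ≃+* A) :
    IsNormalization (f.comp (e : A' →+* A)) where
  isDomain := hf.isDomain
  isIntegrallyClosed := hf.isIntegrallyClosed
  isIntegral := (RingHom.isIntegral_of_surjective _ e.surjective).trans _ _ hf.isIntegral
  ker_eq := by
    ext x
    have h : f (e x) = 0 ↔ IsNilpotent (e x) := by
      rw [← RingHom.mem_ker, hf.ker_eq, mem_nilradical]
    rw [RingHom.mem_ker, mem_nilradical]
    exact h.trans (IsNilpotent.map_iff e.injective)
  fraction := fun c => by
    obtain ⟨a, b, hb, hc⟩ := hf.fraction c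
    exact ⟨e.symm a, e.symm b, by simpa using hb, by simpa using hc⟩

end Normalization

/-! ### The orbit polynomial of an element under a finite group. -/

section OrbitPolynomial

variable {G : Type w} [Fintype G] {A : Type*} [CommRing A]

/-- The polynomial `∏ g, (T - g x)` of an element `x` of a ring with an action of `G`. -/
noncomputable def orbitPoly (a : G → A →+* A) (x : A) : Polynomial A :=
  ∏ g, (Polynomial.X - Polynomial.C (a g x))

theorem orbitPoly_monic (a : G → A →+* A) (x : A) : (orbitPoly a x).Monic :=
  Polynomial.monic_prod_of_monic _ _ fun _ _ => Polynomial.monic_X_sub_C _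

theorem map_orbitPoly {A' : Type*} [CommRing A'] (a : G → A →+* A) (a' : G → A' →+* A')
    (f : A →+* A') (hf : ∀ g x, f (a g x) = a' g (f x)) (x : A) :
    (orbitPoly a x).map f = orbitPoly a' (f x) := by
  simp [orbitPoly, Polynomial.map_prod, hf]

theorem orbitPoly_zero (a : G → A →+* A) : orbitPoly a 0 = Polynomial.X ^ Fintype.card G := by
  simp [orbitPoly]

variable [Group G]

/-- Applying `h` only permutes the factors of the product. -/
theorem orbitPoly_coeff_fixed (a : G → A →+* A) (ha : ∀ g h x, a (g * h) x = a g (a h x)) (x : A)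
    (h : G) (n : ℕ) : a h ((orbitPoly a x).coeff n) = (orbitPoly a x).coeff n := by
  rw [← Polynomial.coeff_map]
  congr 1
  rw [orbitPoly, Polynomial.map_prod]
  simp only [Polynomial.map_sub, Polynomial.map_X, Polynomial.map_C, ← ha]
  exact Fintype.prod_equiv (Equiv.mulLeft h) _ _ fun g => rfl

theorem orbitPoly_eval_self (a : G → A →+* A) (x : A) (h1 : a 1 x = x) :
    (orbitPoly a x).eval x = 0 := by
  rw [orbitPoly, Polynomial.eval_prod]
  exact Finset.prod_eq_zero (Finset.mem_univ 1) (by simp [h1])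

end OrbitPolynomial

/-! ### `Y × 𝔸^ι` as the normalization of the pull-back of its quotient. -/

section Pullback

variable {K : Type v} [Field K] {G : Type w} [Group G] {S : Type u} [CommRing S] [Algebra K S]
  {β : G →* (S ≃ₐ[K] S)} {ι : Type}

/-- The comorphism of the morphism `Y × 𝔸^ι → Y ×_X (Y × 𝔸^ι) / G`. -/
noncomputable def pullbackMap (σ : ProductAction β ι) :
    S ⊗[invariantRing β] quotAlg σ →ₐ[S] MvPolynomial ι S :=
  Algebra.TensorProduct.productLeftAlgHom (Algebra.ofId S _) (quotAlg σ).val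

theorem pullbackMap_tmul (σ : ProductAction β ι) (s : S) (b : quotAlg σ) :
    pullbackMap σ (s ⊗ₜ b) = MvPolynomial.C s * (b : MvPolynomial ι S) := by
  simp [pullbackMap, Algebra.ofId_apply, MvPolynomial.algebraMap_eq]

theorem act_pullbackMap_tmul (σ : ProductAction β ι) (g : G) (s : S) (b : quotAlg σ) :
    σ.act g (pullbackMap σ (s ⊗ₜ b)) = pullbackMap σ (β g s ⊗ₜ b) := by
  rw [pullbackMap_tmul, pullbackMap_tmul, map_mul, σ.compat, b.2 g]

/-- Every `p` is a root of its orbit polynomial, which is monic with coefficients in the invariant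
ring. -/
theorem pullbackMap_isIntegral [Finite G] [Nontrivial S] (σ : ProductAction β ι) :
    (pullbackMap σ : S ⊗[invariantRing β] quotAlg σ →+* MvPolynomial ι S).IsIntegral := by
  intro p
  have := Fintype.ofFinite G
  let a : G → MvPolynomial ι S →+* MvPolynomial ι S := fun g => (σ.act g : _ →+* _)
  have ha : ∀ g h x, a (g * h) x = a g (a h x) := fun g h x => σ.act_mul_apply g h x
  let i : S ⊗[invariantRing β] quotAlg σ →+* MvPolynomial ι S := pullbackMap σ
  have h1 : orbitPoly a p ∈ Polynomial.lifts i := by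
    rw [Polynomial.lifts_iff_coeff_lifts]
    intro n
    let b : quotAlg σ := ⟨(orbitPoly a p).coeff n, fun g => orbitPoly_coeff_fixed a ha p g n⟩
    refine ⟨1 ⊗ₜ b, ?_⟩
    exact (pullbackMap_tmul σ 1 b).trans (by rw [map_one, one_mul])
  obtain ⟨q, hq, -, hqm⟩ :=
    Polynomial.lifts_and_degree_eq_and_monic h1 (orbitPoly_monic a p)
  refine ⟨q, hqm, ?_⟩
  rw [← Polynomial.eval_map]
  change Polynomial.eval p (q.map i) = 0
  rw [hq]
  exact orbitPoly_eval_self a p (by simp [a])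

/-- The kernel of `S ⊗ S[W_i]^G → S[W_i]` consists of nilpotent elements: the norm polynomial of
`∑ s_i T_i` has coefficients in `S^G`, and specializes to a power of the variable. -/
theorem isNilpotent_of_pullbackMap_eq_zero [Finite G] (σ : ProductAction β ι)
    (x : S ⊗[invariantRing β] quotAlg σ) (hx : pullbackMap σ x = 0) : IsNilpotent x := by
  have := Fintype.ofFinite G
  let J := quotAlg σ
  -- The tensor product is presented by a polynomial ring over `S` with one variable for each
  -- invariant. There `G` acts on coefficients alone, and the invariants are exactly the polynomials
  -- over `S^G`; invariants of the tensor product itself are not as easily described.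
  let v : MvPolynomial J S →ₐ[S] S ⊗[invariantRing β] quotAlg σ :=
    MvPolynomial.aeval fun b => (1 : S) ⊗ₜ b
  let v' : MvPolynomial J S →+* S ⊗[invariantRing β] quotAlg σ := v
  have hv : Function.Surjective v := by
    intro y
    induction y using TensorProduct.induction_on with
    | zero => exact ⟨0, map_zero v⟩
    | tmul s b =>
      refine ⟨s • MvPolynomial.X b, ?_⟩
      rw [map_smul]
      simp [v, TensorProduct.smul_tmul']
    | add y z hy hz =>
      obtain ⟨p, rfl⟩ := hy
      obtain ⟨q, rfl⟩ := hz
      exact ⟨p + q, map_add v p q⟩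
  obtain ⟨l, rfl⟩ := hv x
  let a : G → MvPolynomial J S →+* MvPolynomial J S := fun g => MvPolynomial.map (β g : S →+* S)
  have ha : ∀ g h p, a (g * h) p = a g (a h p) := fun g h p => by
    simp only [a, MvPolynomial.map_map]
    congr 2
    ext s
    simp
  let a' : G → MvPolynomial ι S →+* MvPolynomial ι S := fun g => (σ.act g : _ →+* _)
  let w : MvPolynomial J S →+* MvPolynomial ι S := ((pullbackMap σ).comp v : MvPolynomial J S →ₐ[S] MvPolynomial ι S)
  have hwC : ∀ s, w (MvPolynomial.C s) = MvPolynomial.C s := fun s =>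
    ((pullbackMap σ).comp v).commutes s
  have hwX : ∀ b : J, w (MvPolynomial.X b) = (b : MvPolynomial ι S) := fun b => by
    change pullbackMap σ (v _) = _
    rw [MvPolynomial.aeval_X, pullbackMap_tmul, map_one, one_mul]
  have hw : ∀ g p, w (a g p) = a' g (w p) := fun g p => by
    have e : w.comp (a g) = (a' g).comp w := by
      refine MvPolynomial.ringHom_ext (fun s => ?_) fun b => ?_
      · simp [a, a', hwC, σ.compat]
      · simp only [RingHom.comp_apply, a, MvPolynomial.map_X, hwX]
        exact (b.2 g).symm
    exact RingHom.congr_fun e p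
  let i : MvPolynomial J (invariantRing β) →+* MvPolynomial J S :=
    MvPolynomial.map (invariantRing β).val.toRingHom
  let u : MvPolynomial J (invariantRing β) →+* quotAlg σ :=
    (MvPolynomial.aeval (fun b : J => b) : MvPolynomial J (invariantRing β) →ₐ[_] quotAlg σ)
  have hu1 : ∀ p, w (i p) = (u p : MvPolynomial ι S) := fun p => by
    have e : w.comp i = (quotAlg σ).val.toRingHom.comp u := by
      refine MvPolynomial.ringHom_ext (fun s => ?_) fun b => ?_
      · simp only [RingHom.comp_apply, i, MvPolynomial.map_C, hwC, u]
        simp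
      · simp only [RingHom.comp_apply, i, MvPolynomial.map_X, hwX, u]
        simp
    exact RingHom.congr_fun e p
  have hu2 : ∀ p, v (i p) = (1 : S) ⊗ₜ u p := fun p => by
    have e : v'.comp i = (Algebra.TensorProduct.includeRight :
        quotAlg σ →ₐ[invariantRing β] S ⊗[invariantRing β] quotAlg σ).toRingHom.comp u := by
      refine MvPolynomial.ringHom_ext (fun s => ?_) fun b => ?_
      · simp only [RingHom.comp_apply, i, MvPolynomial.map_C, u]
        simp [v, v']
      · simp [i, u, v, v']
    exact RingHom.congr_fun e p
  have h1 : orbitPoly a l ∈ Polynomial.lifts i := by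
    rw [Polynomial.lifts_iff_coeff_lifts]
    intro n
    have h2 := fun g => orbitPoly_coeff_fixed a ha l g n
    generalize (orbitPoly a l).coeff n = c at h2
    have h3 : c ∈ Set.range (MvPolynomial.map (σ := J) (invariantRing β).val.toRingHom) := by
      rw [MvPolynomial.mem_range_map_iff_coeffs_subset]
      intro s hs
      obtain ⟨m, -, rfl⟩ := MvPolynomial.mem_coeffs_iff.mp hs
      refine ⟨⟨c.coeff m, fun g => ?_⟩, rfl⟩
      have h4 := congrArg (MvPolynomial.coeff m) (h2 g)
      rw [MvPolynomial.coeff_map] at h4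
      exact h4
    exact h3
  obtain ⟨q, hq⟩ := (Polynomial.mem_lifts _).mp h1
  -- Checked inside `S[W]`, which contains the invariant ring: there `l` maps to `0`, whose orbit
  -- polynomial is a power of the variable.
  have h5 : q.map u = Polynomial.X ^ Fintype.card G := by
    apply Polynomial.map_injective (quotAlg σ).val.toRingHom Subtype.val_injective
    have e : (quotAlg σ).val.toRingHom.comp u = w.comp i := RingHom.ext fun p => (hu1 p).symm
    have hwl : w l = 0 := hx
    rw [Polynomial.map_map, e, ← Polynomial.map_map, hq, map_orbitPoly a a' w hw, hwl,
      orbitPoly_zero, Polynomial.map_pow, Polynomial.map_X]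
  -- On polynomials over `S^G` the map `v'` factors through the invariant ring, so `h5` carries over
  -- to the tensor product. As `l` is a root of its orbit polynomial, a power of `v l` vanishes.
  have h6 : (orbitPoly a l).map v' = Polynomial.X ^ Fintype.card G := by
    have e : v'.comp i = (Algebra.TensorProduct.includeRight :
        quotAlg σ →ₐ[invariantRing β] S ⊗[invariantRing β] quotAlg σ).toRingHom.comp u :=
      RingHom.ext hu2
    rw [← hq, Polynomial.map_map, e, ← Polynomial.map_map, h5, Polynomial.map_pow,
      Polynomial.map_X]
  have h7 := congrArg v'
    (orbitPoly_eval_self a l (by simp only [a, map_one]; exact MvPolynomial.map_id l))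
  rw [map_zero, ← Polynomial.eval_map_apply, h6, Polynomial.eval_pow, Polynomial.eval_X] at h7
  exact ⟨_, h7⟩

/-- A function on `Y × Y` that vanishes on the graphs of all `g ≠ 1` but not on the whole diagonal.
Faithfulness gives for each `g ≠ 1` some `a g` moved by `g`; the product of the `a g ⊗ 1 - 1 ⊗ β g
(a g)` works because `S` is a domain. -/
theorem exists_separating [Finite G] [IsDomain S] (hβ : Function.Injective β) :
    ∃ z : S ⊗[K] S, Algebra.TensorProduct.lmul' K z ≠ 0 ∧
      ∀ g, g ≠ 1 → Algebra.TensorProduct.productMap (β g : S →ₐ[K] S) (AlgHom.id K S) z = 0 := by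
  classical
  have := Fintype.ofFinite G
  have h1 : ∀ g : G, g ≠ 1 → ∃ a, β g a ≠ a := fun g hg => by
    by_contra! h
    exact hg (hβ (by rw [map_one]; exact AlgEquiv.ext h))
  choose! a ha using h1
  refine ⟨∏ g ∈ Finset.univ.erase 1, (a g ⊗ₜ 1 - 1 ⊗ₜ β g (a g)), ?_, fun g hg => ?_⟩
  · rw [map_prod, Finset.prod_ne_zero_iff]
    intro g hg
    have := ha g (Finset.ne_of_mem_erase hg)
    simpa [sub_eq_zero] using this.symm
  · rw [map_prod]
    exact Finset.prod_eq_zero (Finset.mem_erase.mpr ⟨hg, Finset.mem_univ g⟩) (by simp)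

/-- For `z = ∑ s_i ⊗ t_i`, the element `∑ t_i · tr(s_i p)`, with `tr` the sum over `G`, lies in the
image. Reordered, it is the sum over `g` of `g p` with coefficient `∑ β_g(s_i) t_i`. If `z` is
separating, only the term of `g = 1` survives, and it is a nonzero element of `S` times `p`. -/
theorem pullbackMap_fraction [Finite G] [IsDomain S] (hβ : Function.Injective β)
    (σ : ProductAction β ι) (p : MvPolynomial ι S) :
    ∃ a b, pullbackMap σ b ≠ 0 ∧ pullbackMap σ b * p = pullbackMap σ a := by
  classical
  have := Fintype.ofFinite G
  obtain ⟨z, hz1, hz2⟩ := exists_separating (K := K) (β := β) hβ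
  have h1 : ∀ y : S ⊗[K] S, ∑ g, MvPolynomial.C
      (Algebra.TensorProduct.productMap (β g : S →ₐ[K] S) (AlgHom.id K S) y) * σ.act g p ∈
      (pullbackMap σ).range := by
    intro y
    induction y using TensorProduct.induction_on with
    | zero => simp
    | tmul s t =>
      let b : quotAlg σ := ⟨∑ g, σ.act g (MvPolynomial.C s * p), fun h => by
        rw [map_sum]
        simp only [← σ.act_mul_apply]
        exact Fintype.sum_equiv (Equiv.mulLeft h) _ _ fun g => rfl⟩
      refine ⟨t ⊗ₜ b, (pullbackMap_tmul σ t b).trans ?_⟩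
      simp only [b, Finset.mul_sum]
      refine Finset.sum_congr rfl fun g _ => ?_
      simp [σ.compat]
      ring
    | add y z hy hz =>
      simp only [map_add, add_mul, Finset.sum_add_distrib]
      exact Subalgebra.add_mem _ hy hz
  obtain ⟨x, hx⟩ := h1 z
  refine ⟨x, Algebra.TensorProduct.lmul' K z ⊗ₜ 1, ?_, ?_⟩
  · rw [pullbackMap_tmul]
    simpa using hz1
  · refine Eq.trans ?_ hx.symm
    rw [pullbackMap_tmul, Finset.sum_eq_single 1]
    · have e : Algebra.TensorProduct.productMap (β 1 : S →ₐ[K] S) (AlgHom.id K S) =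
          Algebra.TensorProduct.lmul' K := by
        ext <;> simp
      rw [e]
      simp
    · intro g _ hg
      rw [hz2 g hg, map_zero, zero_mul]
    · simp

theorem isIntegrallyClosed_mvPolynomial [IsDomain S] [IsIntegrallyClosed S] [Finite ι] :
    IsIntegrallyClosed (MvPolynomial ι S) := by
  refine Finite.induction_empty_option (P := fun α => IsIntegrallyClosed (MvPolynomial α S))
    (fun {α γ} e h => ?_) ?_ (fun {α} _ h => ?_) ι
  · exact IsIntegrallyClosed.of_equiv (MvPolynomial.renameEquiv S e).toRingEquiv
  · exact IsIntegrallyClosed.of_equiv (MvPolynomial.isEmptyRingEquiv S PEmpty).symm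
  · exact IsIntegrallyClosed.of_equiv (MvPolynomial.optionEquivLeft S α).symm.toRingEquiv

/-- `Y × 𝔸^ι` is the normalization of `Y ×_X (Y × 𝔸^ι) / G`. -/
theorem isNormalization_pullbackMap [Finite G] [IsDomain S] [IsIntegrallyClosed S] [Finite ι]
    (hβ : Function.Injective β) (σ : ProductAction β ι) :
    IsNormalization (pullbackMap σ : S ⊗[invariantRing β] quotAlg σ →+* MvPolynomial ι S) where
  isDomain := inferInstance
  isIntegrallyClosed := isIntegrallyClosed_mvPolynomial
  isIntegral := pullbackMap_isIntegral σ
  ker_eq := by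
    ext x
    rw [RingHom.mem_ker, mem_nilradical]
    exact ⟨isNilpotent_of_pullbackMap_eq_zero σ x, fun h => (h.map (pullbackMap σ)).eq_zero⟩
  fraction := pullbackMap_fraction hβ σ

end Pullback

/-! ### Bundle isomorphisms induce linear isomorphisms of the quotients. -/

section LinearMorphisms

variable {K : Type v} [Field K] {G : Type w} [Group G] {S : Type u} [CommRing S] [Algebra K S]
  {β : G →* (S ≃ₐ[K] S)}

/-- The product of two morphisms over `Y` of trivial vector bundles, on functions. -/
noncomputable def sumHom {ι κ ι' κ' : Type} (f : MvPolynomial ι S →ₐ[S] MvPolynomial κ S)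
    (f' : MvPolynomial ι' S →ₐ[S] MvPolynomial κ' S) :
    MvPolynomial (ι ⊕ ι') S →ₐ[S] MvPolynomial (κ ⊕ κ') S :=
  MvPolynomial.aeval (Sum.elim
    (fun i => MvPolynomial.rename Sum.inl (f (MvPolynomial.X i)))
    (fun i => MvPolynomial.rename Sum.inr (f' (MvPolynomial.X i))))

theorem sumHom_rename_inl {ι κ ι' κ' : Type} (f : MvPolynomial ι S →ₐ[S] MvPolynomial κ S)
    (f' : MvPolynomial ι' S →ₐ[S] MvPolynomial κ' S) (p : MvPolynomial ι S) :
    sumHom f f' (MvPolynomial.rename Sum.inl p) = MvPolynomial.rename Sum.inl (f p) := by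
  have e : (sumHom f f').comp (MvPolynomial.rename Sum.inl) =
      (MvPolynomial.rename Sum.inl).comp f :=
    MvPolynomial.algHom_ext fun i => by simp [sumHom]
  exact AlgHom.congr_fun e p

theorem sumHom_rename_inr {ι κ ι' κ' : Type} (f : MvPolynomial ι S →ₐ[S] MvPolynomial κ S)
    (f' : MvPolynomial ι' S →ₐ[S] MvPolynomial κ' S) (p : MvPolynomial ι' S) :
    sumHom f f' (MvPolynomial.rename Sum.inr p) = MvPolynomial.rename Sum.inr (f' p) := by
  have e : (sumHom f f').comp (MvPolynomial.rename Sum.inr) =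
      (MvPolynomial.rename Sum.inr).comp f' :=
    MvPolynomial.algHom_ext fun i => by simp [sumHom]
  exact AlgHom.congr_fun e p

theorem sumHom_equivariant {ι κ ι' κ' : Type} {σ : ProductAction β ι} {τ : ProductAction β κ}
    {σ' : ProductAction β ι'} {τ' : ProductAction β κ'}
    {f : MvPolynomial ι S →ₐ[S] MvPolynomial κ S}
    {f' : MvPolynomial ι' S →ₐ[S] MvPolynomial κ' S}
    (hf : ∀ g p, τ.act g (f p) = f (σ.act g p))
    (hf' : ∀ g p, τ'.act g (f' p) = f' (σ'.act g p)) (g : G) (p : MvPolynomial (ι ⊕ ι') S) :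
    (τ.sum τ').act g (sumHom f f' p) = sumHom f f' ((σ.sum σ').act g p) := by
  refine equivariant_of_X (σ.sum σ') (τ.sum τ') _ (fun g i => ?_) g p
  rcases i with i | i
  · rw [← MvPolynomial.rename_X (R := S) Sum.inl i, sumHom_rename_inl,
      ProductAction.sum_act_inl, ProductAction.sum_act_inl, sumHom_rename_inl, hf]
  · rw [← MvPolynomial.rename_X (R := S) Sum.inr i, sumHom_rename_inr,
      ProductAction.sum_act_inr, ProductAction.sum_act_inr, sumHom_rename_inr, hf']

theorem coe_quotMap {ι κ : Type} {σ : ProductAction β ι} {τ : ProductAction β κ}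
    {f : MvPolynomial ι S →ₐ[S] MvPolynomial κ S} (hf : ∀ g p, τ.act g (f p) = f (σ.act g p))
    (x : quotAlg σ) : (quotMap σ τ f hf x : MvPolynomial κ S) = f x :=
  rfl

theorem coe_prL {ι κ : Type} (σ : ProductAction β ι) (τ : ProductAction β κ) (x : quotAlg σ) :
    (prL σ τ x : MvPolynomial (ι ⊕ κ) S) = MvPolynomial.rename Sum.inl (x : MvPolynomial ι S) :=
  rfl

theorem coe_prR {ι κ : Type} (σ : ProductAction β ι) (τ : ProductAction β κ) (x : quotAlg τ) :
    (prR σ τ x : MvPolynomial (ι ⊕ κ) S) = MvPolynomial.rename Sum.inr (x : MvPolynomial κ S) :=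
  rfl

/-- The addition of a trivial vector bundle, on functions. -/
noncomputable def bundleCoadd (S : Type u) [CommRing S] (ι : Type) :
    MvPolynomial ι S →ₐ[S] MvPolynomial (ι ⊕ ι) S :=
  MvPolynomial.aeval fun i => MvPolynomial.X (Sum.inl i) + MvPolynomial.X (Sum.inr i)

theorem coe_coadd {ι : Type} (σ : ProductAction β ι) (x : quotAlg σ) :
    (coadd σ x : MvPolynomial (ι ⊕ ι) S) = bundleCoadd S ι (x : MvPolynomial ι S) :=
  rfl

/-- The scalar multiplication of a trivial vector bundle, on functions. -/
noncomputable def bundleCosmul (S : Type u) [CommRing S] (ι : Type) :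
    MvPolynomial ι S →ₐ[S] MvPolynomial (ι ⊕ Unit) S :=
  MvPolynomial.aeval fun i => MvPolynomial.X (Sum.inr ()) * MvPolynomial.X (Sum.inl i)

theorem coe_cosmul {ι : Type} (σ : ProductAction β ι) (x : quotAlg σ) :
    (cosmul σ x : MvPolynomial (ι ⊕ Unit) S) = bundleCosmul S ι (x : MvPolynomial ι S) :=
  rfl

theorem sumHom_bundleCoadd {ι : Type} {f : MvPolynomial ι S →ₐ[S] MvPolynomial ι S}
    (hlin : ∀ i, f (MvPolynomial.X i) ∈
      Submodule.span S (Set.range (MvPolynomial.X : ι → MvPolynomial ι S)))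
    (p : MvPolynomial ι S) : sumHom f f (bundleCoadd S ι p) = bundleCoadd S ι (f p) := by
  have e : (sumHom f f).comp (bundleCoadd S ι) = (bundleCoadd S ι).comp f := by
    refine MvPolynomial.algHom_ext fun i => ?_
    rw [AlgHom.comp_apply, AlgHom.comp_apply, bundleCoadd, MvPolynomial.aeval_X, map_add,
      ← MvPolynomial.rename_X (R := S) Sum.inl i, sumHom_rename_inl,
      ← MvPolynomial.rename_X (R := S) Sum.inr i, sumHom_rename_inr]
    have h := hlin i
    generalize f (MvPolynomial.X i) = q at h ⊢
    induction h using Submodule.span_induction with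
    | mem x hx => obtain ⟨j, rfl⟩ := hx; simp
    | zero => simp
    | add x y _ _ hx hy => simp only [map_add, ← hx, ← hy]; ring
    | smul a x _ hx => simp only [map_smul, ← smul_add, hx]
  exact AlgHom.congr_fun e p

theorem sumHom_bundleCosmul {ι : Type} {f : MvPolynomial ι S →ₐ[S] MvPolynomial ι S}
    (hlin : ∀ i, f (MvPolynomial.X i) ∈
      Submodule.span S (Set.range (MvPolynomial.X : ι → MvPolynomial ι S)))
    (p : MvPolynomial ι S) :
    sumHom f (AlgHom.id S (MvPolynomial Unit S)) (bundleCosmul S ι p) =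
      bundleCosmul S ι (f p) := by
  have e : (sumHom f (AlgHom.id S (MvPolynomial Unit S))).comp (bundleCosmul S ι) =
      (bundleCosmul S ι).comp f := by
    refine MvPolynomial.algHom_ext fun i => ?_
    rw [AlgHom.comp_apply, AlgHom.comp_apply, bundleCosmul, MvPolynomial.aeval_X, map_mul,
      ← MvPolynomial.rename_X (R := S) Sum.inl i, sumHom_rename_inl,
      ← MvPolynomial.rename_X (R := S) Sum.inr (), sumHom_rename_inr, AlgHom.id_apply]
    have h := hlin i
    generalize f (MvPolynomial.X i) = q at h ⊢
    induction h using Submodule.span_induction with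
    | mem x hx => obtain ⟨j, rfl⟩ := hx; simp
    | zero => simp
    | add x y _ _ hx hy => simp only [map_add, mul_add, hx, hy]
    | smul a x _ hx => simp only [map_smul, mul_smul_comm, hx]
  exact AlgHom.congr_fun e p

/-- The required lifts are induced by `f × id` on `Y × 𝔸^ι × 𝔸^1` and by `f × f` on `Y × 𝔸^ι × 𝔸^ι`;
linearity of `f` makes them commute with the bundle operations before passing to invariants. -/
theorem isLinearComorphism_quotMap {ι : Type} {σ τ : ProductAction β ι}
    {f : MvPolynomial ι S →ₐ[S] MvPolynomial ι S} (hf : ∀ g p, τ.act g (f p) = f (σ.act g p))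
    (hlin : ∀ i, f (MvPolynomial.X i) ∈
      Submodule.span S (Set.range (MvPolynomial.X : ι → MvPolynomial ι S))) :
    IsLinearComorphism (quotMap σ τ f hf) := by
  have hline : ∀ g p, (lineAction β).act g (AlgHom.id S (MvPolynomial Unit S) p) =
      AlgHom.id S _ ((lineAction β).act g p) := fun _ _ => rfl
  refine ⟨⟨quotMap _ _ (sumHom f (AlgHom.id S _)) (sumHom_equivariant hf hline), ?_, ?_, ?_⟩,
    ⟨quotMap _ _ (sumHom f f) (sumHom_equivariant hf hf), ?_, ?_, ?_⟩⟩ <;>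
    refine AlgHom.ext fun x => Subtype.ext ?_ <;>
    simp only [AlgHom.comp_apply, coe_quotMap, coe_prL, coe_prR, coe_cosmul, coe_coadd,
      sumHom_rename_inl, sumHom_rename_inr, sumHom_bundleCoadd hlin, sumHom_bundleCosmul hlin,
      AlgHom.id_apply]

theorem IsBundleIso.linearlyIsomorphic {ι : Type} {σ τ : ProductAction β ι}
    {ψ : MvPolynomial ι S ≃ₐ[K] MvPolynomial ι S} (h : IsBundleIso AlgEquiv.refl ψ σ τ) :
    LinearlyIsomorphic σ τ := by
  let f : MvPolynomial ι S ≃ₐ[S] MvPolynomial ι S :=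
    AlgEquiv.ofRingEquiv (f := ψ.toRingEquiv) h.over_base
  have hf : ∀ g p, τ.act g (f p) = f (σ.act g p) := fun g p => (h.equivariant g p).symm
  have hf' : ∀ g p, σ.act g (f.symm p) = f.symm (τ.act g p) := fun g p => by
    rw [← f.injective.eq_iff, ← hf, f.apply_symm_apply, f.apply_symm_apply]
  let F := quotMap σ τ (f : MvPolynomial ι S →ₐ[S] MvPolynomial ι S) hf
  let F' := quotMap τ σ (f.symm : MvPolynomial ι S →ₐ[S] MvPolynomial ι S) hf'
  have h1 : F.comp F' = AlgHom.id _ _ :=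
    AlgHom.ext fun x => Subtype.ext (f.apply_symm_apply (x : MvPolynomial ι S))
  have h2 : F'.comp F = AlgHom.id _ _ :=
    AlgHom.ext fun x => Subtype.ext (f.symm_apply_apply (x : MvPolynomial ι S))
  exact ⟨AlgEquiv.ofAlgHom F F' h1 h2, isLinearComorphism_quotMap hf h.linear,
    isLinearComorphism_quotMap hf' h.linear_symm⟩

end LinearMorphisms

/-! ### From isomorphic quotients to equivariant isomorphisms over `Y`. -/

section QuotientSchemes

variable {K : Type v} [Field K] {G : Type w} [Group G] {S : Type u} [CommRing S] [Algebra K S]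
  {β : G →* (S ≃ₐ[K] S)} {ι : Type}

/-- `Spec` is fully faithful, and a morphism over `X` corresponds to an algebra homomorphism over
`S^G`. -/
theorem nonempty_quotScheme_iso_iff (σ τ : ProductAction β ι) :
    Nonempty (quotScheme σ ≅ quotScheme τ) ↔
      Nonempty (quotAlg σ ≃ₐ[invariantRing β] quotAlg τ) := by
  constructor
  · rintro ⟨e⟩
    let i : Spec (CommRingCat.of (quotAlg τ)) ≅ Spec (CommRingCat.of (quotAlg σ)) :=
      (Over.forget _).mapIso e.symm
    let r : CommRingCat.of (quotAlg σ) ≅ CommRingCat.of (quotAlg τ) :=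
      { hom := Spec.preimage i.hom
        inv := Spec.preimage i.inv
        hom_inv_id := Spec.map_injective (by simp)
        inv_hom_id := Spec.map_injective (by simp) }
    have hr : CommRingCat.ofHom (algebraMap (invariantRing β) (quotAlg σ)) ≫ r.hom =
        CommRingCat.ofHom (algebraMap (invariantRing β) (quotAlg τ)) := by
      apply Spec.map_injective
      rw [Spec.map_comp, Spec.map_preimage]
      exact Over.w e.inv
    exact ⟨AlgEquiv.ofRingEquiv (f := r.commRingCatIsoToRingEquiv) fun x =>
      RingHom.congr_fun (congrArg CommRingCat.Hom.hom hr) x⟩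
  · rintro ⟨e⟩
    refine ⟨Over.isoMk (Scheme.Spec.mapIso e.symm.toRingEquiv.toCommRingCatIso.symm.op.symm) ?_⟩
    change Spec.map _ ≫ Spec.map _ = Spec.map _
    rw [← Spec.map_comp]
    exact congrArg Spec.map (CommRingCat.hom_ext (RingHom.ext e.symm.commutes))

/-- Base change of `e` to `S` identifies the two pull-backs, compatibly with `G` acting on the first
factor. -/
theorem IsNormalizedPullback.of_algEquiv [Finite G] [IsDomain S] [IsIntegrallyClosed S] [Finite ι]
    (hβ : Function.Injective β) {σ τ : ProductAction β ι}
    (e : quotAlg σ ≃ₐ[invariantRing β] quotAlg τ) : IsNormalizedPullback τ (quotAlg σ) := by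
  let E : S ⊗[invariantRing β] quotAlg σ ≃ₐ[S] S ⊗[invariantRing β] quotAlg τ :=
    Algebra.TensorProduct.congr AlgEquiv.refl e
  refine ⟨(pullbackMap τ).comp (E : _ →ₐ[S] _), fun g s a => ?_, ?_⟩
  · exact (act_pullbackMap_tmul τ g s (e a)).symm
  · exact (isNormalization_pullbackMap hβ τ).comp_equiv E.toRingEquiv

/-- A product action that normalizes the pull-back of the quotient by `σ` is isomorphic to `σ`
by an equivariant isomorphism over `Y`, which need not be linear. -/
theorem IsNormalizedPullback.exists_equivariant [Finite G] [IsDomain S] [IsIntegrallyClosed S]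
    [Finite ι] (hβ : Function.Injective β) {σ τ : ProductAction β ι}
    (h : IsNormalizedPullback τ (quotAlg σ)) :
    ∃ ψ : MvPolynomial ι S ≃ₐ[S] MvPolynomial ι S,
      ∀ g p, ψ (σ.act g p) = τ.act g (ψ p) := by
  obtain ⟨ν, hν, hn⟩ := h
  have hσ := isNormalization_pullbackMap hβ σ
  obtain ⟨e, he⟩ := hσ.exists_ringEquiv hn
  have he' : ∀ a, e (pullbackMap σ a) = ν a := he
  have heC : ∀ s, e (MvPolynomial.C s) = MvPolynomial.C s := fun s => by
    have := he' (algebraMap S _ s)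
    rwa [AlgHom.commutes, AlgHom.commutes] at this
  refine ⟨AlgEquiv.ofRingEquiv (f := e) heC, fun g p => ?_⟩
  -- Equivariance holds on the image of the pull-back, and a suitable homomorphism from a
  -- normalization to a domain is determined there.
  have key : (e : MvPolynomial ι S →+* MvPolynomial ι S).comp
      (σ.act g : MvPolynomial ι S →+* MvPolynomial ι S) =
      (τ.act g : MvPolynomial ι S →+* MvPolynomial ι S).comp
        (e : MvPolynomial ι S →+* MvPolynomial ι S) := by
    refine hσ.ringHom_ext (RingHom.ext fun a => ?_) fun b hb => ?_
    · change e (σ.act g (pullbackMap σ a)) = τ.act g (e (pullbackMap σ a))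
      induction a using TensorProduct.induction_on with
      | zero => simp
      | tmul s b => rw [act_pullbackMap_tmul, he', he', hν]
      | add x y hx hy => simp only [map_add, hx, hy]
    · change e (σ.act g (pullbackMap σ b)) ≠ 0
      rw [map_ne_zero_iff _ e.injective, map_ne_zero_iff _ (σ.act g).injective]
      exact hb
  exact RingHom.congr_fun key p

end QuotientSchemes

/-! ### Linearizing equivariant isomorphisms. -/

section Correspondence

variable {K : Type v} [Field K] {G : Type w} [Group G] {S : Type u} [CommRing S] [Algebra K S]
  {β : G →* (S ≃ₐ[K] S)} {ι : Type}

/-- Product actions that are isomorphic by a possibly non-linear equivariant isomorphism over an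
automorphism of `Y` are isomorphic as equivariant vector bundles over `Y`. -/
theorem exists_isBundleIso_of_equivariant [Nontrivial S] [Finite ι] {ε : S →ₐ[K] K}
    (hε : IsFixedPoint β ε) {σ τ : ProductAction β ι} (φ : S ≃ₐ[K] S)
    (ψ : MvPolynomial ι S ≃ₐ[K] MvPolynomial ι S)
    (hψ : ∀ s, ψ (MvPolynomial.C s) = MvPolynomial.C (φ s))
    (heq : ∀ g p, ψ (σ.act g p) = τ.act g (ψ p)) :
    ∃ ψ', IsBundleIso AlgEquiv.refl ψ' σ τ := by
  classical
  have := Fintype.ofFinite ι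
  obtain ⟨ρ, rfl⟩ := exists_eq_prodAction β σ
  obtain ⟨ρ', rfl⟩ := exists_eq_prodAction β τ
  obtain ⟨P, hP⟩ := rep_equiv_of_equivariant hε φ ψ hψ heq
  exact ⟨_, isBundleIso_linEquiv (P := P⁻¹) fun g => by rw [hP, inv_inv]⟩

end Correspondence

/-! ### The two bijections of equivalence classes. -/

section Bijections

variable {K : Type v} [Field K] {G : Type w} [Group G] {S : Type u} [CommRing S] [Algebra K S]
  {β : G →* (S ≃ₐ[K] S)} {m : ℕ}

theorem prodAction_equiv_iff [Nontrivial S] {ε : S →ₐ[K] K} (hε : IsFixedPoint β ε)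
    (ρ ρ' : G →* GL (Fin m) K) :
    (productActionSetoid β m).r (prodAction β ρ) (prodAction β ρ') ↔
      (repSetoid K G m).r ρ ρ' := by
  constructor
  · rintro ⟨ψ, hψ⟩
    exact rep_equiv_of_equivariant hε AlgEquiv.refl ψ hψ.over_base hψ.equivariant
  · rintro ⟨P, hP⟩
    exact ⟨_, isBundleIso_linEquiv (P := P⁻¹) fun g => by rw [hP, inv_inv]⟩

/-- The bijection `ρ ↦ β × ρ` on equivalence classes. -/
noncomputable def repClassEquiv [Nontrivial S] {ε : S →ₐ[K] K} (hε : IsFixedPoint β ε) (m : ℕ) :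
    RepClass K G m ≃ ProductActionClass β m :=
  Equiv.ofBijective
    (Quotient.map (prodAction β) fun ρ ρ' h => (prodAction_equiv_iff hε ρ ρ').mpr h) (by
      constructor
      · rintro ⟨ρ⟩ ⟨ρ'⟩ h
        exact Quotient.sound ((prodAction_equiv_iff hε ρ ρ').mp (Quotient.exact h))
      · rintro ⟨σ⟩
        obtain ⟨ρ, rfl⟩ := exists_eq_prodAction β σ
        exact ⟨Quotient.mk _ ρ, rfl⟩)

/-- The non-formal link of the cycle: uniqueness of normalization gives an equivariant isomorphism
over `Y`, and its derivative at the fixed point replaces it by a linear one. -/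
theorem productAction_equiv_of_isNormalizedPullback [Finite G] [IsDomain S] [IsIntegrallyClosed S]
    (hβ : Function.Injective β) {ε : S →ₐ[K] K} (hε : IsFixedPoint β ε)
    {σ τ : ProductAction β (Fin m)} (h : IsNormalizedPullback τ (quotAlg σ)) :
    (productActionSetoid β m).r σ τ := by
  obtain ⟨ψ, hψ⟩ := h.exists_equivariant hβ
  exact exists_isBundleIso_of_equivariant hε AlgEquiv.refl (ψ.restrictScalars K) ψ.commutes hψ

theorem isNormalizedPullback_of_iso [Finite G] [IsDomain S] [IsIntegrallyClosed S]
    (hβ : Function.Injective β) {σ τ : ProductAction β (Fin m)}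
    (h : Nonempty (quotScheme σ ≅ quotScheme τ)) : IsNormalizedPullback τ (quotAlg σ) := by
  obtain ⟨e⟩ := (nonempty_quotScheme_iso_iff σ τ).mp h
  exact IsNormalizedPullback.of_algEquiv hβ e

theorem LinearlyIsomorphic.nonempty_iso {σ τ : ProductAction β (Fin m)}
    (h : LinearlyIsomorphic σ τ) : Nonempty (quotScheme σ ≅ quotScheme τ) :=
  (nonempty_quotScheme_iso_iff σ τ).mpr ⟨h.choose⟩

theorem linearlyIsomorphic_of_equiv {σ τ : ProductAction β (Fin m)}
    (h : (productActionSetoid β m).r σ τ) : LinearlyIsomorphic σ τ :=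
  h.choose_spec.linearlyIsomorphic

/-- The bijection `σ ↦ ((Y × 𝔸^m) / σ → X)` on equivalence classes. -/
noncomputable def quotClassEquiv [Finite G] [IsDomain S] [IsIntegrallyClosed S]
    (hβ : Function.Injective β) {ε : S →ₐ[K] K} (hε : IsFixedPoint β ε) (m : ℕ) :
    ProductActionClass β m ≃ QuotClass β m :=
  Equiv.ofBijective
    (Quotient.map quotObj fun _ _ h => (linearlyIsomorphic_of_equiv h).nonempty_iso) (by
      constructor
      · rintro ⟨σ⟩ ⟨τ⟩ h
        exact Quotient.sound (productAction_equiv_of_isNormalizedPullback hβ hε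
          (isNormalizedPullback_of_iso hβ (Quotient.exact h)))
      · rintro ⟨Z, σ, ⟨e⟩⟩
        exact ⟨Quotient.mk _ σ, Quotient.sound ⟨e.symm⟩⟩)

end Bijections

end QuotientCorrespondence

theorem mainTheorem2 {K : Type v} [Field K] {G : Type w} [Group G] [Finite G]
    {S : Type u} [CommRing S] [IsDomain S] [IsIntegrallyClosed S] [Algebra K S]
    (β : G →* (S ≃ₐ[K] S)) (hβ : Function.Injective β)
    (ε : S →ₐ[K] K) (hε : IsFixedPoint β ε)
    (hε_unique : ∀ ε' : S →ₐ[K] K, IsFixedPoint β ε' → ε' = ε) (m : ℕ) :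
    ∃ (Φ : RepClass K G m ≃ ProductActionClass β m)
      (Ψ : ProductActionClass β m ≃ QuotClass β m),
      -- the correspondences are `ρ ↦ β × ρ` and `σ ↦ ((Y × 𝔸^m) / σ → X)`
      (∀ ρ : G →* GL (Fin m) K,
        Φ (Quotient.mk (repSetoid K G m) ρ) =
          Quotient.mk (productActionSetoid β m) (prodAction β ρ)) ∧
      (∀ σ : ProductAction β (Fin m),
        Ψ (Quotient.mk (productActionSetoid β m) σ) =
          Quotient.mk (quotSetoid β m) (quotObj σ)) ∧
      -- inverse of `Φ`: restrict the action to the fiber over the fixed point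
      (∀ σ : ProductAction β (Fin m), ∃! ρ : G →* GL (Fin m) K, IsFiberRep ε σ ρ) ∧
      (∀ (σ : ProductAction β (Fin m)) (ρ : G →* GL (Fin m) K), IsFiberRep ε σ ρ →
        Φ.symm (Quotient.mk (productActionSetoid β m) σ) = Quotient.mk (repSetoid K G m) ρ) ∧
      -- inverse of `Ψ`: normalize the pull-back to `Y`
      (∀ σ τ : ProductAction β (Fin m),
        Ψ.symm (Quotient.mk (quotSetoid β m) (quotObj σ)) =
            Quotient.mk (productActionSetoid β m) τ ↔
          IsNormalizedPullback τ (quotAlg σ)) ∧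
      -- an equivalence over an equivariant automorphism of `Y` implies equivalence over `Y`
      (∀ σ τ : ProductAction β (Fin m), (∃ φ ψ, IsBundleIso φ ψ σ τ) →
        Quotient.mk (productActionSetoid β m) σ = Quotient.mk (productActionSetoid β m) τ) ∧
      -- for quotient schemes, isomorphism and linear isomorphism over `X` are the same
      (∀ σ τ : ProductAction β (Fin m),
        Nonempty (quotScheme σ ≅ quotScheme τ) ↔ LinearlyIsomorphic σ τ) := by
  refine ⟨repClassEquiv hε m, quotClassEquiv hβ hε m, fun _ => rfl, fun _ => rfl, ?_, ?_, ?_, ?_, ?_⟩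
  · intro σ
    obtain ⟨ρ, rfl⟩ := exists_eq_prodAction β σ
    exact ⟨ρ, isFiberRep_prodAction hε ρ, fun ρ' h => h.unique (isFiberRep_prodAction hε ρ)⟩
  · intro σ ρ h
    obtain ⟨ρ', rfl⟩ := exists_eq_prodAction β σ
    obtain rfl := h.unique (isFiberRep_prodAction hε ρ')
    rw [Equiv.symm_apply_eq]
    rfl
  · intro σ τ
    -- The left side now says that the quotients of `σ` and `τ` are isomorphic over `X`, so both
    -- directions are taken from the cycle of implications.
    rw [Equiv.symm_apply_eq]
    constructor
    · exact fun h => isNormalizedPullback_of_iso hβ (Quotient.exact h)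
    · exact fun h => Quotient.sound (linearlyIsomorphic_of_equiv
        (productAction_equiv_of_isNormalizedPullback hβ hε h)).nonempty_iso
  · rintro σ τ ⟨φ, ψ, h⟩
    exact Quotient.sound
      (exists_isBundleIso_of_equivariant hε φ ψ h.over_base h.equivariant)
  · intro σ τ
    exact ⟨fun h => linearlyIsomorphic_of_equiv (productAction_equiv_of_isNormalizedPullback hβ hε
      (isNormalizedPullback_of_iso hβ h)), LinearlyIsomorphic.nonempty_iso⟩
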